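/- Let $\mathbb S^1=\mathbb R/2\pi\mathbb Z$, let $\Omega=\mathbb R\times\mathbb S^1$ with coordinates $(t,x)$ and Laplacian $\Delta=\partial_t^2+\partial_x^2$, and identify $L^2(\Omega)$ with $L^2(\mathbb R;L^2(\mathbb S^1))$. Let $\mathcal A^\dagger$ be the C*-algebra of bounded operators on $L^2(\Omega)$ generated by the multiplication operators $a(M_x)$, $(a(M_x)u)(t,x)=a(x)u(t,x)$, with $a\in C^\infty(\mathbb S^1)$, together with $$\Lambda=(1-\Delta)^{-1/2},\qquad \tfrac1i\,\partial_t\Lambda,\qquad \tfrac1i\,\partial_x\Lambda .$$ Let $F$ be the unitary Fourier transform in the variable $t$, $(Fu)(\tau)=\frac1{\sqrt{2\pi}}\int_{\mathbb R}e^{-it\tau}u(t)\,dt$, and put $\mathcal B^\dagger=F^{-1}\mathcal A^\dagger F$. The commutator ideal of a C*-algebra $A$ is the closed two-sided ideal of $A$ generated by all commutators $ab-ba$, $a,b\in A$. Let $\mathcal K(L^2(\mathbb S^1))$ denote the compact operators on $L^2(\mathbb S^1)$, and identify a function $f\in C_0(\mathbb R,\mathcal K(L^2(\mathbb S^1)))$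 with the operator $f(M_t)$ on $L^2(\mathbb R;L^2(\mathbb S^1))$, $(f(M_t)u)(t)=f(t)u(t)$. Theorem. The commutator ideal of $\mathcal B^\dagger$ is $C_0(\mathbb R,\mathcal K(L^2(\mathbb S^1)))$, that is, it is equal to $\{f(M_t) : f\in C_0(\mathbb R,\mathcal K(L^2(\mathbb S^1)))\}$. -/

import Mathlib

open MeasureTheory Filter Topology Complex
open scoped ENNReal BoundedContinuousFunction ZeroAtInfty ContDiff

noncomputable section

namespace CylinderAlgebra

/-! ### Operator-valued multiplication operators -/

section Multiplication

variable {X E : Type*} [TopologicalSpace X] [SecondCountableTopology X]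
  [MeasurableSpace X] [OpensMeasurableSpace X] [NormedAddCommGroup E] [InnerProductSpace ℂ E]

theorem memLp_apply (μ : Measure X) (f : X →ᵇ (E →L[ℂ] E)) (u : Lp E 2 μ) :
    MemLp (fun x => f x (u x)) 2 μ := by
  refine MemLp.of_le_mul (c := ‖f‖) (Lp.memLp u) ?_ ?_
  · exact isBoundedBilinearMap_apply.continuous.comp_aestronglyMeasurable₂
      f.continuous.aestronglyMeasurable (Lp.aestronglyMeasurable u)
  · refine Eventually.of_forall fun x => ((f x).le_opNorm _).trans ?_
    gcongr
    exact f.norm_coe_le_norm x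

/-- The multiplication operator `u ↦ (x ↦ f x (u x))` on `L²(X, μ; E)`. -/
def mulCLM (μ : Measure X) (f : X →ᵇ (E →L[ℂ] E)) : Lp E 2 μ →L[ℂ] Lp E 2 μ :=
  LinearMap.mkContinuous
    { toFun := fun u => (memLp_apply μ f u).toLp _
      map_add' := fun u v => by
        rw [← MemLp.toLp_add]
        refine MemLp.toLp_congr _ _ ?_
        filter_upwards [Lp.coeFn_add u v] with x hx
        rw [hx, Pi.add_apply, Pi.add_apply, map_add]
      map_smul' := fun c u => by
        rw [RingHom.id_apply, ← MemLp.toLp_const_smul]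
        refine MemLp.toLp_congr _ _ ?_
        filter_upwards [Lp.coeFn_smul c u] with x hx
        rw [hx, Pi.smul_apply, Pi.smul_apply, map_smul] }
    ‖f‖ fun u => by
      refine Lp.norm_le_mul_norm_of_ae_le_mul ?_
      filter_upwards [(memLp_apply μ f u).coeFn_toLp] with x hx
      refine (le_of_eq (congrArg norm hx)).trans (((f x).le_opNorm _).trans ?_)
      gcongr
      exact f.norm_coe_le_norm x

theorem mulCLM_apply (μ : Measure X) (f : X →ᵇ (E →L[ℂ] E)) (u : Lp E 2 μ) :
    ∀ᵐ x ∂μ, mulCLM μ f u x = f x (u x) :=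
  (memLp_apply μ f u).coeFn_toLp

/-- `f ↦ f(M)` is a `*`-homomorphism from `C_b(X, L(E))` to the bounded operators on
`L²(X, μ; E)`; through it bounded continuous operator-valued functions act on `L²(X, μ; E)`. -/
def mulOp [CompleteSpace E] (μ : Measure X) :
    (X →ᵇ (E →L[ℂ] E)) →⋆ₐ[ℂ] (Lp E 2 μ →L[ℂ] Lp E 2 μ) where
  toFun := mulCLM μ
  map_one' := by
    ext1 u; refine Lp.ext ?_
    filter_upwards [mulCLM_apply μ 1 u] with x hx
    simp [hx]
  map_mul' f g := by
    ext1 u; refine Lp.ext ?_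
    filter_upwards [mulCLM_apply μ (f * g) u, mulCLM_apply μ g u,
      mulCLM_apply μ f (mulCLM μ g u)] with x h1 h2 h3
    simp [h1, h2, h3]
  map_zero' := by
    ext1 u; refine Lp.ext ?_
    filter_upwards [mulCLM_apply μ 0 u, Lp.coeFn_zero E 2 μ] with x h1 h2
    exact h1.trans h2.symm
  map_add' f g := by
    ext1 u; refine Lp.ext ?_
    filter_upwards [mulCLM_apply μ (f + g) u, mulCLM_apply μ f u, mulCLM_apply μ g u,
      Lp.coeFn_add (mulCLM μ f u) (mulCLM μ g u)] with x h1 h2 h3 h4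
    refine h1.trans (Eq.trans ?_ h4.symm)
    rw [Pi.add_apply, h2, h3]
    rfl
  commutes' c := by
    ext1 u; refine Lp.ext ?_
    filter_upwards [mulCLM_apply μ (algebraMap ℂ _ c) u, Lp.coeFn_smul c u] with x h1 h2
    refine h1.trans (Eq.trans ?_ h2.symm)
    simp [Algebra.algebraMap_eq_smul_one]
  map_star' f := by
    rw [ContinuousLinearMap.star_eq_adjoint]
    refine (ContinuousLinearMap.eq_adjoint_iff _ _).2 fun u v => ?_
    rw [L2.inner_def, L2.inner_def]
    refine integral_congr_ae ?_
    filter_upwards [mulCLM_apply μ (star f) u, mulCLM_apply μ f v] with x h1 h2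
    simp [h1, h2, ContinuousLinearMap.star_eq_adjoint, ContinuousLinearMap.adjoint_inner_left]

theorem mulOp_apply [CompleteSpace E] (μ : Measure X) (f : X →ᵇ (E →L[ℂ] E)) (u : Lp E 2 μ) :
    ∀ᵐ x ∂μ, mulOp μ f u x = f x (u x) :=
  mulCLM_apply μ f u

end Multiplication

/-! ### The Fourier transform on `L²(ℝ; E)` -/

section Fourier

variable {E : Type*} [NormedAddCommGroup E]

theorem memLp_dilate (c : ℝ) (hc : c ≠ 0) (u : Lp E 2 (volume : Measure ℝ)) :
    MemLp (fun t => u (c * t)) 2 (volume : Measure ℝ) := by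
  have h : MemLp u 2 (Measure.map (fun t : ℝ => c * t) volume) := by
    rw [Real.map_volume_mul_left hc]
    exact (Lp.memLp u).smul_measure ENNReal.ofReal_ne_top
  exact h.comp_of_map (by fun_prop)

theorem quasi_dilate (c : ℝ) (hc : c ≠ 0) :
    Measure.QuasiMeasurePreserving (fun t : ℝ => c * t) volume volume := by
  refine ⟨by fun_prop, ?_⟩
  rw [Real.map_volume_mul_left hc]
  exact Measure.smul_absolutelyContinuous

variable [InnerProductSpace ℂ E]

/-- The unitary dilation `(D_c u)(t) = |c|^{1/2} u(c t)`, as a linear isometry. -/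
def dilateIsometry (c : ℝ) (hc : c ≠ 0) :
    Lp E 2 (volume : Measure ℝ) →ₗᵢ[ℂ] Lp E 2 (volume : Measure ℝ) where
  toFun u := ((Real.sqrt |c| : ℝ) : ℂ) • (memLp_dilate c hc u).toLp _
  map_add' u v := by
    rw [← smul_add, ← MemLp.toLp_add]
    congr 1
    refine MemLp.toLp_congr _ _ ?_
    filter_upwards [(quasi_dilate c hc).ae (Lp.coeFn_add u v)] with x hx
    simpa using hx
  map_smul' a u := by
    rw [RingHom.id_apply, smul_comm a]
    congr 1
    rw [← MemLp.toLp_const_smul]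
    refine MemLp.toLp_congr _ _ ?_
    filter_upwards [(quasi_dilate c hc).ae (Lp.coeFn_smul a u)] with x hx
    simpa using hx
  norm_map' u := by
    have hc' : 0 < |c| := abs_pos.2 hc
    have h : ‖(memLp_dilate c hc u).toLp (fun t => u (c * t))‖ = (Real.sqrt |c|)⁻¹ * ‖u‖ := by
      rw [Lp.norm_toLp, Lp.norm_def]
      have : eLpNorm (fun t => u (c * t)) 2 volume
          = eLpNorm u 2 (Measure.map (fun t : ℝ => c * t) volume) := by
        rw [eLpNorm_map_measure ?_ (by fun_prop)]
        · rfl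
        · rw [Real.map_volume_mul_left hc]
          exact (Lp.aestronglyMeasurable u).smul_measure _
      rw [this, Real.map_volume_mul_left hc,
        eLpNorm_smul_measure_of_ne_top (by norm_num), smul_eq_mul, ENNReal.toReal_mul,
        ← ENNReal.toReal_rpow, ENNReal.toReal_ofReal (abs_nonneg _), abs_inv,
        Real.sqrt_eq_rpow, ← Real.inv_rpow hc'.le]
      simp
    simp only [LinearMap.coe_mk, AddHom.coe_mk]
    rw [norm_smul, h, norm_real, Real.norm_of_nonneg (Real.sqrt_nonneg _), ← mul_assoc,
      mul_inv_cancel₀ (Real.sqrt_pos.2 hc').ne', one_mul]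

theorem dilateIsometry_apply (c : ℝ) (hc : c ≠ 0) (u : Lp E 2 (volume : Measure ℝ)) :
    ∀ᵐ t : ℝ, dilateIsometry c hc u t = ((Real.sqrt |c| : ℝ) : ℂ) • u (c * t) := by
  filter_upwards [Lp.coeFn_smul ((Real.sqrt |c| : ℝ) : ℂ) ((memLp_dilate c hc u).toLp _),
    (memLp_dilate c hc u).coeFn_toLp] with t h1 h2
  simp only [Pi.smul_apply, h2] at h1
  exact h1

theorem dilateIsometry_dilateIsometry (c : ℝ) (hc : c ≠ 0) (u : Lp E 2 (volume : Measure ℝ)) :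
    dilateIsometry c hc (dilateIsometry c⁻¹ (inv_ne_zero hc) u) = u := by
  refine Lp.ext ?_
  filter_upwards [dilateIsometry_apply c hc (dilateIsometry c⁻¹ (inv_ne_zero hc) u),
    (quasi_dilate c hc).ae (dilateIsometry_apply c⁻¹ (inv_ne_zero hc) u)] with t h1 h2
  have hs : Real.sqrt |c| ≠ 0 := (Real.sqrt_pos.2 (abs_pos.2 hc)).ne'
  rw [h1, h2, smul_smul, ← mul_assoc, inv_mul_cancel₀ hc, one_mul, ← ofReal_mul, abs_inv,
    Real.sqrt_inv, mul_inv_cancel₀ hs, ofReal_one, one_smul]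

/-- The unitary dilation `(D_c u)(t) = |c|^{1/2} u(c t)` on `L²(ℝ; E)`. -/
def dilate (c : ℝ) (hc : c ≠ 0) :
    Lp E 2 (volume : Measure ℝ) ≃ₗᵢ[ℂ] Lp E 2 (volume : Measure ℝ) :=
  LinearIsometryEquiv.ofSurjective (dilateIsometry c hc)
    fun u => ⟨_, dilateIsometry_dilateIsometry c hc u⟩

/-- The unitary Fourier transform `(F u)(τ) = (2π)^{-1/2} ∫ e^{-itτ} u(t) dt` on `L²(ℝ; E)`.
Mathlib's Fourier transform has the kernel `e^{-2πitτ}`, hence the dilation by `(2π)⁻¹`. -/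
def fourierL2 [CompleteSpace E] :
    Lp E 2 (volume : Measure ℝ) ≃ₗᵢ[ℂ] Lp E 2 (volume : Measure ℝ) :=
  (Lp.fourierTransformₗᵢ ℝ E).trans (dilate (2 * Real.pi)⁻¹ (inv_ne_zero Real.two_pi_pos.ne'))

end Fourier

/-! ### The cylinder `ℝ × 𝕊¹` and weak derivatives -/

instance factTwoPiPos : Fact (0 < 2 * Real.pi) := ⟨Real.two_pi_pos⟩

/-- The circle `ℝ / 2πℤ` (length `2π`). -/
abbrev Circ : Type := AddCircle (2 * Real.pi)

/-- `L²(𝕊¹)`. -/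
abbrev L2Circ : Type := Lp ℂ 2 (volume : Measure Circ)

/-- `L²(ℝ × 𝕊¹)`, realised as `L²(ℝ; L²(𝕊¹))`. -/
abbrev L2Cyl : Type := Lp L2Circ 2 (volume : Measure ℝ)

/-- A function on the circle is smooth if its `2π`-periodic lift to `ℝ` is. -/
def SmoothOnCirc (a : Circ → ℂ) : Prop := ContDiff ℝ ∞ fun x : ℝ => a (x : Circ)

/-- Test functions on the cylinder: smooth functions with compact support. -/
structure IsTestFunction (φ : ℝ × Circ → ℂ) : Prop where
  smooth : ContDiff ℝ ∞ fun p : ℝ × ℝ => φ (p.1, (p.2 : Circ))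
  compactSupport : HasCompactSupport φ

/-- The partial derivative along the line. -/
def derivT (φ : ℝ × Circ → ℂ) (p : ℝ × Circ) : ℂ := deriv (fun s : ℝ => φ (p.1 + s, p.2)) 0

/-- The partial derivative along the circle (with respect to the angle). -/
def derivX (φ : ℝ × Circ → ℂ) (p : ℝ × Circ) : ℂ :=
  deriv (fun s : ℝ => φ (p.1, p.2 + (s : Circ))) 0

/-- The Laplacian of a function on the cylinder. -/
def lap (φ : ℝ × Circ → ℂ) (p : ℝ × Circ) : ℂ := derivT (derivT φ) p + derivX (derivX φ) p

/-- The bilinear pairing `∫_{ℝ × 𝕊¹} u φ`. -/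
def pair (u : L2Cyl) (φ : ℝ × Circ → ℂ) : ℂ := ∫ t : ℝ, ∫ x : Circ, u t x * φ (t, x)

/-- `∂u/∂t = g` in the sense of distributions. -/
def HasWeakDerivT (u g : L2Cyl) : Prop :=
  ∀ φ, IsTestFunction φ → pair g φ = -pair u (derivT φ)

/-- `∂u/∂x = g` in the sense of distributions. -/
def HasWeakDerivX (u g : L2Cyl) : Prop :=
  ∀ φ, IsTestFunction φ → pair g φ = -pair u (derivX φ)

/-- `u` is in the domain of the self-adjoint Laplacian of the cylinder and `Δu = g`
(the domain consists of all `u ∈ L²` with distributional Laplacian in `L²`). -/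
def HasWeakLaplacian (u g : L2Cyl) : Prop :=
  ∀ φ, IsTestFunction φ → pair g φ = pair u (lap φ)

/-! ### The algebras -/

/-- The operator `a(M_x)` of multiplication by a function `a` on the circle:
`(a(M_x) u)(t, x) = a(x) u(t, x)`. -/
def mulCirc (a : C(Circ, ℂ)) : L2Cyl →L[ℂ] L2Cyl :=
  mulOp volume (BoundedContinuousFunction.const ℝ
    (mulOp (volume : Measure Circ) (BoundedContinuousFunction.mkOfCompact
      ⟨fun x => a x • (1 : ℂ →L[ℂ] ℂ), by fun_prop⟩)))

/-- `Λ = (1 - Δ)^{-1/2}`: the operator `Λ` is bounded and positive, and `Λ²` is the inverse of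
`1 - Δ`, that is, `Λ²u = v` if and only if `v` is in the domain of `Δ` and `v - Δv = u`.
These properties determine `Λ`. -/
def IsLambda (Λ : L2Cyl →L[ℂ] L2Cyl) : Prop :=
  Λ.IsPositive ∧ ∀ u v : L2Cyl, Λ (Λ u) = v ↔ HasWeakLaplacian v (v - u)

/-- The generators: `a(M_x)` with `a` smooth, `Λ`, `(1/i) ∂_t Λ` and `(1/i) ∂_x Λ`. -/
def generators : Set (L2Cyl →L[ℂ] L2Cyl) :=
  {T | ∃ a : C(Circ, ℂ), SmoothOnCirc a ∧ T = mulCirc a} ∪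
  {Λ | IsLambda Λ} ∪
  {T | ∃ Λ, IsLambda Λ ∧ ∀ u, ∃ g, HasWeakDerivT (Λ u) g ∧ T u = (1 / I) • g} ∪
  {T | ∃ Λ, IsLambda Λ ∧ ∀ u, ∃ g, HasWeakDerivX (Λ u) g ∧ T u = (1 / I) • g}

/-- The C*-algebra `𝒜†` generated by the generators (they include the identity). -/
def Adagger : StarSubalgebra ℂ (L2Cyl →L[ℂ] L2Cyl) :=
  (StarAlgebra.adjoin ℂ generators).topologicalClosure

/-- The C*-algebra `ℬ† = F⁻¹ 𝒜† F`, where `F` is the Fourier transform in the variable of `ℝ`. -/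
def Bdagger : StarSubalgebra ℂ (L2Cyl →L[ℂ] L2Cyl) :=
  Adagger.map ((fourierL2 (E := L2Circ)).symm.conjStarAlgEquiv :
    (L2Cyl →L[ℂ] L2Cyl) →⋆ₐ[ℂ] (L2Cyl →L[ℂ] L2Cyl))

/-- The commutator ideal: the smallest closed two-sided ideal that contains all commutators. -/
def commutatorIdeal (A : Type*) [Ring A] [TopologicalSpace A] : TwoSidedIdeal A :=
  sInf {J | IsClosed (J : Set A) ∧ ∀ a b : A, a * b - b * a ∈ J}

/-- The compact operators `K(L²(𝕊¹))`. -/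
abbrev KCirc : Submodule ℂ (L2Circ →L[ℂ] L2Circ) :=
  compactOperator (RingHom.id ℂ) L2Circ L2Circ

/-- The operator `f(M_t)` on `L²(ℝ; L²(𝕊¹))`, `(f(M_t) u)(t) = f(t) u(t)`, for a function
`f ∈ C₀(ℝ, K(L²(𝕊¹)))`. -/
def mulC0 (f : C₀(ℝ, KCirc)) : L2Cyl →L[ℂ] L2Cyl :=
  mulOp volume (f.toBCF.comp Subtype.val (LipschitzWith.subtype_val (KCirc : Set _)))

end CylinderAlgebra

end

/-! All generators commute with translations in `t`, so conjugation by `F` turns them into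
multiplication operators in the dual variable `τ`, with values in the bounded operators on `L²(𝕊¹)`.
In the basis of exponentials, `a(M_x)` becomes a constant function, while `Λ`, `(1/i)∂_t Λ` and
`(1/i)∂_x Λ` become diagonal with entries `λ`, `-τλ` and `jλ`, where `λ(τ,j) = (1+τ²+j²)^{-1/2}`
(`generators_eq`). Identifying `Λ` requires that `1 - Δ` be injective on `L²` and that positive
square roots be unique (`isLambda_iff`). Since `f ↦ f(M)` is an injective, hence isometric,
`*`-homomorphism, `ℬ†` may be replaced by the closed algebra `Bsymb` of symbols (`mem_Bdagger`).

Upper bound. The symbols in `C₀(ℝ, K)` form a closed ideal of all bounded continuous symbols.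
Multiplication by `e^{ikx}` shifts the basis, so its commutator with a diagonal symbol is that shift
times the diagonal of the differences `h(τ,j) - h(τ,j+k)`. For the three diagonal generators these
are bounded by a constant times `λ(τ,j+k)`: they tend to zero in `j` for fixed `τ` (compactness) and
uniformly in `j` as `|τ| → ∞` (`commutator_fourier_mem`). Density of trigonometric polynomials
handles general `a`, and commutation modulo a closed ideal passes from generators to the generated
algebra (`commutator_mem_of_generators`).

Lower bound. Let `I` be a closed ideal of `Bsymb` containing all commutators. Then `e^{-ix}[e^{ix},
Λ]` gives a diagonal element of `I` with entries `λ(τ,j) - λ(τ,j+1)`, which never vanish. Its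
products with `1`, `λ`, `-τλ`, `jλ` separate the points of the one-point compactification of `ℝ ×
ℤ`, so by Stone–Weierstrass `I` contains every diagonal symbol in `C₀(ℝ × ℤ)`
(`diagSymb_toSeq_mem`). Placing exponentials on both sides of `ψ ⊗ δ₀` produces `ψ` times any matrix
unit (`smul_matrixUnit_mem`), and sums of these are dense in `C₀(ℝ, K)` (`mem_of_matrixUnit_mem`).
-/

noncomputable section

namespace CylinderAlgebra

open scoped ComplexOrder

/-! ### Diagonal operators -/

section Diagonal

variable {ι H : Type*} [NormedAddCommGroup H] [InnerProductSpace ℂ H]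

theorem ext_repr (b : HilbertBasis ι ℂ H) {v w : H} (h : ∀ i, b.repr v i = b.repr w i) : v = w :=
  b.repr.injective (lp.ext (funext h))

theorem repr_basis [DecidableEq ι] (b : HilbertBasis ι ℂ H) (j i : ι) :
    b.repr (b j) i = if i = j then 1 else 0 := by
  rw [b.repr_self, lp.single_apply, Pi.single_apply]

/-- Two bounded operators that agree on a Hilbert basis are equal. -/
theorem clm_ext_basis {E : Type*} [NormedAddCommGroup E] [NormedSpace ℂ E]
    (b : HilbertBasis ι ℂ H) {S T : H →L[ℂ] E}
    (h : ∀ j, S (b j) = T (b j)) : S = T := by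
  refine ContinuousLinearMap.ext_on (s := Set.range b) ?_ ?_
  · rw [dense_iff_closure_eq]
    have := b.dense_span
    rw [← Submodule.topologicalClosure_coe, this]; rfl
  · rintro _ ⟨j, rfl⟩; exact h j

/-- The rank one operator `v ↦ ⟪b j, v⟫ b i`. -/
def matrixUnit (b : HilbertBasis ι ℂ H) (i j : ι) : H →L[ℂ] H :=
  (innerSL ℂ (b j)).smulRight (b i)

theorem matrixUnit_apply (b : HilbertBasis ι ℂ H) (i j : ι) (v : H) :
    matrixUnit b i j v = b.repr v j • b i := by
  simp [matrixUnit, b.repr_apply_apply]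

theorem isCompactOperator_matrixUnit (b : HilbertBasis ι ℂ H) (i j : ι) :
    IsCompactOperator (matrixUnit b i j) := by
  have : matrixUnit b i j = (ContinuousLinearMap.smulRight (1 : ℂ →L[ℂ] ℂ) (b i)).comp
      (innerSL ℂ (b j)) := by
    ext v; simp [matrixUnit]
  rw [this]
  exact (isCompactOperator_id.clm_comp
    (ContinuousLinearMap.smulRight (1 : ℂ →L[ℂ] ℂ) (b i))).comp_clm _

variable [TopologicalSpace ι]

theorem memℓp_bounded_mul (h : ι →ᵇ ℂ) (v : lp (fun _ : ι => ℂ) 2) :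
    Memℓp (fun i => h i * v i) 2 := by
  refine memℓp_gen ?_
  have hv := (lp.memℓp v).summable (by norm_num)
  refine Summable.of_nonneg_of_le (fun i => by positivity) (fun i => ?_)
    (hv.mul_left (‖h‖ ^ (2 : ℝ≥0∞).toReal))
  rw [norm_mul, Real.mul_rpow (norm_nonneg _) (norm_nonneg _)]
  gcongr
  exact h.norm_coe_le_norm i

/-- The diagonal operator with bounded diagonal `h` in the orthonormal basis `b`. -/
def diagCLM (b : HilbertBasis ι ℂ H) (h : ι →ᵇ ℂ) : H →L[ℂ] H :=
  LinearMap.mkContinuous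
    { toFun := fun v => b.repr.symm ⟨fun i => h i * b.repr v i, memℓp_bounded_mul h _⟩
      map_add' := fun u v => by
        rw [← map_add]; congr 1; ext i; exact (by simp [mul_add] :
          h i * b.repr (u + v) i = h i * b.repr u i + h i * b.repr v i)
      map_smul' := fun c u => by
        rw [RingHom.id_apply, ← map_smul]; congr 1; ext i; simp [mul_left_comm] }
    ‖h‖ fun v => by
      simp only [LinearMap.coe_mk, AddHom.coe_mk, LinearIsometryEquiv.norm_map]
      rw [← b.repr.norm_map v]
      refine lp.norm_le_of_tsum_le (by norm_num) (by positivity) ?_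
      rw [Real.mul_rpow (norm_nonneg _) (norm_nonneg _),
        lp.norm_rpow_eq_tsum (by norm_num) (b.repr v), ← tsum_mul_left]
      have hv := (lp.memℓp (b.repr v)).summable (by norm_num)
      refine Summable.tsum_le_tsum (fun i => ?_) ((memℓp_bounded_mul h (b.repr v)).summable (by norm_num))
        (hv.mul_left _)
      simp only [norm_mul]
      rw [Real.mul_rpow (norm_nonneg _) (norm_nonneg _)]
      gcongr
      exact h.norm_coe_le_norm i

theorem repr_diagCLM (b : HilbertBasis ι ℂ H) (h : ι →ᵇ ℂ) (v : H) (i : ι) :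
    b.repr (diagCLM b h v) i = h i * b.repr v i := by
  simp [diagCLM]

theorem norm_diagCLM_le (b : HilbertBasis ι ℂ H) (h : ι →ᵇ ℂ) : ‖diagCLM b h‖ ≤ ‖h‖ :=
  LinearMap.mkContinuous_norm_le _ (norm_nonneg _) _

/-- Bounded sequences act as diagonal operators. -/
def diag [CompleteSpace H] (b : HilbertBasis ι ℂ H) : (ι →ᵇ ℂ) →⋆ₐ[ℂ] (H →L[ℂ] H) where
  toFun := diagCLM b
  map_one' := by ext1 v; refine ext_repr b fun i => ?_; simp [repr_diagCLM]
  map_mul' f g := by ext1 v; refine ext_repr b fun i => ?_; simp [repr_diagCLM, mul_assoc]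
  map_zero' := by ext1 v; refine ext_repr b fun i => ?_; simp [repr_diagCLM]
  map_add' f g := by ext1 v; refine ext_repr b fun i => ?_; simp [repr_diagCLM, add_mul]
  commutes' c := by
    ext1 v; refine ext_repr b fun i => ?_
    simp [repr_diagCLM, Algebra.algebraMap_eq_smul_one]
  map_star' f := by
    rw [ContinuousLinearMap.star_eq_adjoint]
    refine (ContinuousLinearMap.eq_adjoint_iff _ _).2 fun u v => ?_
    rw [← b.repr.inner_map_map, ← b.repr.inner_map_map u, lp.inner_eq_tsum, lp.inner_eq_tsum]
    refine tsum_congr fun i => ?_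
    simp [repr_diagCLM]
    ring

theorem repr_diag [CompleteSpace H] (b : HilbertBasis ι ℂ H) (h : ι →ᵇ ℂ) (v : H) (i : ι) :
    b.repr (diag b h v) i = h i * b.repr v i := repr_diagCLM b h v i

theorem norm_diag_le [CompleteSpace H] (b : HilbertBasis ι ℂ H) (h : ι →ᵇ ℂ) :
    ‖diag b h‖ ≤ ‖h‖ := norm_diagCLM_le b h

/-- This is the form of continuity needed to compose a bounded continuous function with `diag`, as
`diagSymb` does. -/
theorem lipschitzWith_diag [CompleteSpace H] (b : HilbertBasis ι ℂ H) :
    LipschitzWith 1 (diag b) := by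
  refine LipschitzWith.of_dist_le_mul fun f g => ?_
  rw [dist_eq_norm, dist_eq_norm, ← map_sub, NNReal.coe_one, one_mul]
  exact norm_diag_le b _

theorem diag_basis [CompleteSpace H] (b : HilbertBasis ι ℂ H) (h : ι →ᵇ ℂ) (j : ι) :
    diag b h (b j) = h j • b j := by
  classical
  refine ext_repr b fun i => ?_
  rw [repr_diag, map_smul, lp.coeFn_smul, Pi.smul_apply, repr_basis]
  by_cases hij : i = j <;> simp [hij]

/-- A diagonal operator whose diagonal tends to zero is compact. -/
theorem isCompactOperator_diag [CompleteSpace H] [DiscreteTopology ι] (b : HilbertBasis ι ℂ H)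
    (h : ι →ᵇ ℂ) (h0 : Tendsto h cofinite (𝓝 0)) : IsCompactOperator (diag b h) := by
  classical
  have hsum : HasSum (fun i => h i • matrixUnit b i i) (diag b h) := by
    rw [HasSum, Metric.tendsto_nhds]
    intro ε hε
    have hfin := (Metric.tendsto_nhds.1 h0) (ε / 2) (by positivity)
    rw [eventually_cofinite] at hfin
    filter_upwards [eventually_ge_atTop hfin.toFinset] with s hs
    -- The remainder after subtracting the finite-rank part over `s`: `s` contains every index with
    -- entry of modulus at least `ε/2`. Halving `ε` makes the final inequality strict.
    let k : ι →ᵇ ℂ := BoundedContinuousFunction.ofNormedAddCommGroup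
      (fun i => if i ∈ s then 0 else h i) continuous_of_discreteTopology (ε / 2) (fun i => by
        split_ifs with his
        · simp; positivity
        · by_contra hcon
          refine his (hs ?_)
          simp only [Set.Finite.mem_toFinset, Set.mem_ofPred_eq, dist_zero_right]
          intro h'; exact hcon h'.le)
    have hk : diag b h - ∑ i ∈ s, h i • matrixUnit b i i = diag b k := by
      refine clm_ext_basis b fun j => ?_
      have : k j = if j ∈ s then 0 else h j := rfl
      rw [diag_basis, this, sub_apply, diag_basis, sum_apply]
      simp only [smul_apply, matrixUnit_apply, repr_basis, ite_smul, one_smul,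
        zero_smul, smul_ite, smul_zero, Finset.sum_ite_eq']
      split_ifs <;> simp
    rw [dist_comm, dist_eq_norm, hk]
    refine (norm_diag_le b k).trans_lt (lt_of_le_of_lt ?_ (half_lt_self hε))
    exact BoundedContinuousFunction.norm_ofNormedAddCommGroup_le _ (by positivity) _
  refine isCompactOperator_of_tendsto hsum (Eventually.of_forall fun s => ?_)
  have : ∑ i ∈ s, h i • matrixUnit b i i ∈ compactOperator (RingHom.id ℂ) H H :=
    Submodule.sum_mem _ fun i _ => Submodule.smul_mem _ _ (isCompactOperator_matrixUnit b i i)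
  exact this

theorem inner_diag_nonneg [CompleteSpace H] (b : HilbertBasis ι ℂ H) (h : ι →ᵇ ℂ)
    (h0 : ∀ i, 0 ≤ h i) (v : H) : 0 ≤ inner ℂ v (diag b h v) := by
  rw [← b.repr.inner_map_map, lp.inner_eq_tsum]
  refine tsum_nonneg fun i => ?_
  have : inner ℂ (b.repr v i) (b.repr (diag b h v) i) = h i * (star (b.repr v i) * b.repr v i) := by
    rw [repr_diag]; simp; ring
  rw [this]
  exact mul_nonneg (h0 i) (star_mul_self_nonneg _)

end Diagonal

/-! ### The Fourier basis of `L²(𝕊¹)` -/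

theorem integral_fourier (n : ℤ) :
    ∫ x : Circ, fourier n x = if n = 0 then ((2 * Real.pi : ℝ) : ℂ) else 0 := by
  split_ifs with h
  · subst h
    simp [AddCircle.measure_univ, Measure.real, Real.pi_pos.le]
  -- Translation by half a period of `e^{inx}` preserves the measure and changes the sign of the
  -- integrand.
  · exact integral_eq_zero_of_add_right_eq_neg (μ := (volume : Measure Circ))
      (fourier_add_half_inv_index h Real.two_pi_pos)

/-- The normalised exponentials in `L²(𝕊¹)`. -/
def expLp (j : ℤ) : L2Circ :=
  (((Real.sqrt (2 * Real.pi))⁻¹ : ℝ) : ℂ) • ContinuousMap.toLp (E := ℂ) 2 volume ℂ (fourier j)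

/-- Here `volume` gives the circle mass `2π`, which the factor `(2π)^{-1/2}` in `expLp` compensates.
-/
theorem orthonormal_expLp : Orthonormal ℂ expLp := by
  rw [orthonormal_iff_ite]
  intro i j
  rw [expLp, expLp, inner_smul_left, inner_smul_right,
    ContinuousMap.inner_toLp (volume : Measure Circ) (fourier i) (fourier j)]
  simp_rw [← fourier_neg, ← fourier_add, integral_fourier]
  have hs : (Real.sqrt (2 * Real.pi)) ≠ 0 := (Real.sqrt_pos.2 Real.two_pi_pos).ne'
  by_cases h : i = j
  · subst h
    simp only [add_neg_cancel, if_true, conj_ofReal]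
    rw [← ofReal_mul, ← ofReal_mul, ← mul_assoc]
    have : (√(2 * Real.pi))⁻¹ * (√(2 * Real.pi))⁻¹ * (2 * Real.pi) = 1 := by
      rw [← mul_inv, Real.mul_self_sqrt Real.two_pi_pos.le, inv_mul_cancel₀ Real.two_pi_pos.ne']
    rw [this, ofReal_one]
  · have : j + -i ≠ 0 := fun h' => h (by omega)
    simp [h, this]

theorem span_expLp : ⊤ ≤ (Submodule.span ℂ (Set.range expLp)).topologicalClosure := by
  have h1 : (Submodule.span ℂ (Set.range fun j : ℤ =>
      ContinuousMap.toLp (E := ℂ) 2 (volume : Measure Circ) ℂ (fourier j))).topologicalClosure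
      = ⊤ := by
    convert! (ContinuousMap.toLp_denseRange ℂ (volume : Measure Circ) ℂ
      (p := 2) (by norm_num)).topologicalClosure_map_submodule span_fourier_closure_eq_top
    rw [Submodule.map_span, Set.range_comp']
    simp only [ContinuousLinearMap.coe_coe]
  rw [← h1]
  refine Submodule.topologicalClosure_mono (Submodule.span_le.2 ?_)
  rintro _ ⟨j, rfl⟩
  have hs : (((Real.sqrt (2 * Real.pi))⁻¹ : ℝ) : ℂ) ≠ 0 :=
    ofReal_ne_zero.2 (inv_ne_zero (Real.sqrt_pos.2 Real.two_pi_pos).ne')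
  have := Submodule.smul_mem (Submodule.span ℂ (Set.range expLp))
    (((Real.sqrt (2 * Real.pi))⁻¹ : ℝ) : ℂ)⁻¹ (Submodule.subset_span ⟨j, rfl⟩)
  rwa [expLp, smul_smul, inv_mul_cancel₀ hs, one_smul] at this

/-- The Fourier basis of `L²(𝕊¹)`. -/
def circBasis : HilbertBasis ℤ ℂ L2Circ := HilbertBasis.mk orthonormal_expLp span_expLp

theorem circBasis_apply (j : ℤ) : circBasis j = expLp j := by
  rw [circBasis, HilbertBasis.coe_mk]

/-! ### Multiplication operators on the circle -/

theorem norm_mulOp_le {X E : Type*} [TopologicalSpace X] [SecondCountableTopology X]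
    [MeasurableSpace X] [OpensMeasurableSpace X] [NormedAddCommGroup E] [InnerProductSpace ℂ E]
    [CompleteSpace E] (μ : Measure X) (f : X →ᵇ (E →L[ℂ] E)) : ‖mulOp μ f‖ ≤ ‖f‖ := by
  refine ContinuousLinearMap.opNorm_le_bound _ (norm_nonneg f) fun u => ?_
  refine Lp.norm_le_mul_norm_of_ae_le_mul ?_
  filter_upwards [mulOp_apply μ f u] with x hx
  rw [hx]
  exact ((f x).le_opNorm _).trans (by gcongr; exact f.norm_coe_le_norm x)

/-- The multiplication operator by a continuous function on the circle. -/
def circMul (a : C(Circ, ℂ)) : L2Circ →L[ℂ] L2Circ :=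
  mulOp (volume : Measure Circ) (BoundedContinuousFunction.mkOfCompact
      ⟨fun x => a x • (1 : ℂ →L[ℂ] ℂ), by fun_prop⟩)

theorem circMul_apply (a : C(Circ, ℂ)) (v : L2Circ) : ∀ᵐ x, circMul a v x = a x * v x := by
  filter_upwards [mulOp_apply (volume : Measure Circ) (BoundedContinuousFunction.mkOfCompact
      ⟨fun x => a x • (1 : ℂ →L[ℂ] ℂ), by fun_prop⟩) v] with x hx
  rw [circMul, hx]; simp

theorem circMul_add (a b : C(Circ, ℂ)) : circMul (a + b) = circMul a + circMul b := by
  rw [circMul, circMul, circMul, ← map_add]; congr 1; ext x : 1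
  exact add_smul (a x) (b x) (1 : ℂ →L[ℂ] ℂ)

theorem circMul_smul (c : ℂ) (b : C(Circ, ℂ)) : circMul (c • b) = c • circMul b := by
  rw [circMul, circMul, ← map_smul]; congr 1; ext x : 1; simp [mul_smul]

theorem circMul_mul (a b : C(Circ, ℂ)) : circMul (a * b) = circMul a * circMul b := by
  rw [circMul, circMul, circMul, ← map_mul]; congr 1; ext x : 1; ext; simp [mul_comm]

theorem star_circMul (a : C(Circ, ℂ)) : star (circMul a) = circMul (star a) := by
  rw [circMul, circMul, ← map_star]; congr 1; ext x : 1
  simp [star_smul]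

theorem norm_circMul_le (a : C(Circ, ℂ)) : ‖circMul a‖ ≤ ‖a‖ := by
  refine (norm_mulOp_le _ _).trans ?_
  refine (BoundedContinuousFunction.norm_le (norm_nonneg _)).2 fun x => ?_
  exact (norm_smul_le (a x) (1 : ℂ →L[ℂ] ℂ)).trans
    (mul_le_of_le_one_right (norm_nonneg (a x)) (ContinuousLinearMap.norm_id_le (𝕜 := ℂ) (E := ℂ))) |>.trans
      (a.norm_coe_le_norm x)

/-- Exponentials act as powers of the bilateral shift; every commutator below is computed from this
formula. -/
theorem circMul_fourier_basis (k j : ℤ) : circMul (fourier k) (circBasis j) = circBasis (j + k) := by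
  rw [circBasis_apply, circBasis_apply, expLp, expLp, map_smul]
  congr 1
  refine Lp.ext ?_
  filter_upwards [circMul_apply (fourier k) (ContinuousMap.toLp (E := ℂ) 2 volume ℂ (fourier j)),
    ContinuousMap.coeFn_toLp (p := 2) (𝕜 := ℂ) (volume : Measure Circ) (fourier j : C(Circ, ℂ)),
    ContinuousMap.coeFn_toLp (p := 2) (𝕜 := ℂ) (volume : Measure Circ)
      (fourier (j + k) : C(Circ, ℂ))] with x h1 h2 h3
  rw [h1, h2, h3, fourier_add, mul_comm]

/-! ### The Fourier transform of Schwartz functions and pointwise operators -/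

section FourierLemmas

open SchwartzMap FourierTransform LineDeriv

variable {E E' : Type*} [NormedAddCommGroup E] [InnerProductSpace ℂ E] [CompleteSpace E]
  [NormedAddCommGroup E'] [InnerProductSpace ℂ E'] [CompleteSpace E']

theorem fourierL2_apply (u : Lp E 2 (volume : Measure ℝ)) :
    fourierL2 u = dilate (2 * Real.pi)⁻¹ (inv_ne_zero Real.two_pi_pos.ne') (𝓕 u) := rfl

theorem dilate_compLp (c : ℝ) (hc : c ≠ 0) (L : E →L[ℂ] E') (u : Lp E 2 (volume : Measure ℝ)) :
    dilate c hc (L.compLp u) = L.compLp (dilate c hc u) := by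
  refine Lp.ext ?_
  filter_upwards [dilateIsometry_apply c hc (L.compLp u), dilateIsometry_apply c hc u,
    (quasi_dilate c hc).ae (L.coeFn_compLp u), L.coeFn_compLp (dilate c hc u)] with t h1 h2 h3 h4
  refine h1.trans ?_
  rw [h3, h4]
  refine Eq.trans ?_ (congrArg L h2.symm)
  rw [map_smul]

theorem toLp_postcompCLM (L : E →L[ℂ] E') (f : 𝓢(ℝ, E)) :
    (f.postcompCLM L).toLp 2 = L.compLp (f.toLp 2 (volume : Measure ℝ)) := by
  refine Lp.ext ?_
  filter_upwards [(f.postcompCLM L).coeFn_toLp 2 (volume : Measure ℝ),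
    f.coeFn_toLp 2 (volume : Measure ℝ),
    L.coeFn_compLp (f.toLp 2 (volume : Measure ℝ))] with t h1 h2 h3
  rw [h1, h3, h2, postcompCLM_apply]

theorem fourier_postcompCLM (L : E →L[ℂ] E') (f : 𝓢(ℝ, E)) :
    𝓕 (f.postcompCLM L) = (𝓕 f).postcompCLM L := by
  ext x
  rw [postcompCLM_apply, fourier_coe, fourier_coe, Real.fourier_eq, Real.fourier_eq,
    ← L.integral_comp_comm]
  · refine integral_congr_ae (Eventually.of_forall fun v => ?_)
    simp [Circle.smul_def]
  · simpa using (Real.fourierIntegral_convergent_iff x).2 f.integrable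

theorem fourierLp_compLp (L : E →L[ℂ] E') (u : Lp E 2 (volume : Measure ℝ)) :
    𝓕 (L.compLp u) = L.compLp (𝓕 u) := by
  refine DenseRange.induction_on
    (p := fun u : Lp E 2 (volume : Measure ℝ) => 𝓕 (L.compLp u) = L.compLp (𝓕 u))
    (SchwartzMap.denseRange_toLpCLM (p := 2) ENNReal.ofNat_ne_top) u ?_ ?_
  · refine isClosed_eq ?_ ?_
    · exact (Lp.fourierTransformₗᵢ ℝ E').continuous.comp (L.compLpL 2 volume).continuous
    · exact (L.compLpL 2 volume).continuous.comp (Lp.fourierTransformₗᵢ ℝ E).continuous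
  · intro f
    rw [toLpCLM_apply, ← toLp_postcompCLM, SchwartzMap.toLp_fourier_eq,
      SchwartzMap.toLp_fourier_eq, fourier_postcompCLM, toLp_postcompCLM]

/-- The Fourier transform commutes with pointwise application of an operator. -/
theorem fourierL2_compLp (L : E →L[ℂ] E') (u : Lp E 2 (volume : Measure ℝ)) :
    fourierL2 (L.compLp u) = L.compLp (fourierL2 u) := by
  rw [fourierL2_apply, fourierL2_apply, fourierLp_compLp, dilate_compLp]

/-- With `L = coeff j` this reduces the `L²(𝕊¹)`-valued transform to scalar ones, where Schwartz
functions are available. -/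
theorem fourierL2_symm_compLp (L : E →L[ℂ] E') (u : Lp E 2 (volume : Measure ℝ)) :
    fourierL2.symm (L.compLp u) = L.compLp (fourierL2.symm u) := by
  rw [LinearIsometryEquiv.symm_apply_eq, fourierL2_compLp, LinearIsometryEquiv.apply_symm_apply]

/-- Dilation of a Schwartz function. -/
def schwartzDilate (c : ℝ) (hc : c ≠ 0) : 𝓢(ℝ, ℂ) →L[ℂ] 𝓢(ℝ, ℂ) :=
  ((Real.sqrt |c| : ℝ) : ℂ) • compCLMOfContinuousLinearEquiv ℂ
    (ContinuousLinearEquiv.unitsEquivAut ℝ (Units.mk0 c hc))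

theorem schwartzDilate_apply (c : ℝ) (hc : c ≠ 0) (f : 𝓢(ℝ, ℂ)) (x : ℝ) :
    schwartzDilate c hc f x = ((Real.sqrt |c| : ℝ) : ℂ) • f (c * x) := by
  simp [schwartzDilate, mul_comm x c]

theorem dilate_toLp (c : ℝ) (hc : c ≠ 0) (f : 𝓢(ℝ, ℂ)) :
    dilate c hc (f.toLp 2) = (schwartzDilate c hc f).toLp 2 := by
  refine Lp.ext ?_
  filter_upwards [dilateIsometry_apply c hc (f.toLp 2 (volume : Measure ℝ)),
    (quasi_dilate c hc).ae (f.coeFn_toLp 2 (volume : Measure ℝ)),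
    (schwartzDilate c hc f).coeFn_toLp 2 (volume : Measure ℝ)] with t h1 h2 h3
  rw [h3, schwartzDilate_apply, ← h2]
  exact h1

theorem exists_fourierL2_toLp (f : 𝓢(ℝ, ℂ)) :
    ∃ g : 𝓢(ℝ, ℂ), fourierL2 (f.toLp 2 (volume : Measure ℝ)) = g.toLp 2 :=
  ⟨_, by rw [fourierL2_apply, SchwartzMap.toLp_fourier_eq, dilate_toLp]⟩

theorem fourierL2_symm_toLp (f : 𝓢(ℝ, ℂ)) :
    fourierL2.symm (f.toLp 2 (volume : Measure ℝ)) =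
      (𝓕⁻ (schwartzDilate (2 * Real.pi) Real.two_pi_pos.ne' f)).toLp 2 := by
  rw [LinearIsometryEquiv.symm_apply_eq, fourierL2_apply, SchwartzMap.toLp_fourier_eq,
    fourier_fourierInv_eq, ← dilate_toLp]
  have := dilateIsometry_dilateIsometry (E := ℂ) (2 * Real.pi)⁻¹
    (inv_ne_zero Real.two_pi_pos.ne') (f.toLp 2 (volume : Measure ℝ))
  simp only [inv_inv] at this
  exact this.symm

theorem lineDeriv_schwartzDilate (c : ℝ) (hc : c ≠ 0) (f : 𝓢(ℝ, ℂ)) :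
    ∂_{(1 : ℝ)} (schwartzDilate c hc f) = c • schwartzDilate c hc (∂_{(1 : ℝ)} f) := by
  ext x
  have h (g : 𝓢(ℝ, ℂ)) (y : ℝ) : (∂_{(1 : ℝ)} g) y = deriv g y := by
    rw [SchwartzMap.lineDerivOp_apply_eq_fderiv, fderiv_apply_one_eq_deriv]
  rw [h, smul_apply, schwartzDilate_apply, h]
  have : (schwartzDilate c hc f : ℝ → ℂ) = fun x => ((Real.sqrt |c| : ℝ) : ℂ) * f (c * x) := by
    ext x; rw [schwartzDilate_apply, smul_eq_mul]
  rw [this, deriv_const_mul_field, deriv_comp_mul_left]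
  simp; ring

/-- The inverse Fourier transform turns `∂ₜ` into multiplication by `-iτ`. -/
theorem fourierL2_symm_deriv (f : 𝓢(ℝ, ℂ)) :
    ∀ᵐ τ : ℝ, fourierL2.symm ((∂_{(1 : ℝ)} f).toLp 2 (volume : Measure ℝ)) τ =
      -(I * τ) * fourierL2.symm (f.toLp 2 (volume : Measure ℝ)) τ := by
  rw [fourierL2_symm_toLp, fourierL2_symm_toLp]
  set g := schwartzDilate (2 * Real.pi) Real.two_pi_pos.ne' f
  -- The chain rule produces a factor `2π`; it cancels the `2π` that the kernel `e^{2πitτ}` produces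
  -- in `h2`.
  have h1 : schwartzDilate (2 * Real.pi) Real.two_pi_pos.ne' (∂_{(1 : ℝ)} f) =
      (((2 * Real.pi)⁻¹ : ℝ) : ℂ) • ∂_{(1 : ℝ)} g := by
    ext x
    rw [lineDeriv_schwartzDilate]
    simp only [smul_apply]
    rw [Complex.real_smul, smul_eq_mul, ← mul_assoc, ← ofReal_mul,
      inv_mul_cancel₀ Real.two_pi_pos.ne']
    simp
  have h2 : 𝓕⁻ (schwartzDilate (2 * Real.pi) Real.two_pi_pos.ne' (∂_{(1 : ℝ)} f)) =
      (((2 * Real.pi)⁻¹ : ℝ) : ℂ) •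
        (-(2 * Real.pi * Complex.I) • smulLeftCLM ℂ (inner ℝ · (1 : ℝ)) (𝓕⁻ g)) := by
    rw [h1, fourierInv_smul, fourierInv_lineDerivOp_eq]
  rw [h2]
  filter_upwards [SchwartzMap.coeFn_toLp ((((2 * Real.pi)⁻¹ : ℝ) : ℂ) •
        (-(2 * Real.pi * Complex.I) • smulLeftCLM ℂ (inner ℝ · (1 : ℝ)) (𝓕⁻ g))) 2
          (volume : Measure ℝ), SchwartzMap.coeFn_toLp (𝓕⁻ g) 2 (volume : Measure ℝ)] with τ h3 h4
  have ht : (inner ℝ · (1 : ℝ) : ℝ → ℝ).HasTemperateGrowth := by fun_prop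
  rw [h3, h4]
  simp only [smul_apply, smulLeftCLM_apply_apply ht]
  have : (Real.pi : ℂ) ≠ 0 := ofReal_ne_zero.2 Real.pi_ne_zero
  simp
  field_simp

end FourierLemmas

/-! ### Test functions on the cylinder -/

section TestFunctions

/-- Smoothness is stated for periodic lifts; this brings continuity down to the cylinder. -/
theorem isOpenQuotientMap_cover :
    IsOpenQuotientMap (fun p : ℝ × ℝ => (p.1, (p.2 : Circ))) :=
  IsOpenQuotientMap.id.prodMap QuotientAddGroup.isOpenQuotientMap_mk

variable {φ : ℝ × Circ → ℂ}

theorem IsTestFunction.continuous (hφ : IsTestFunction φ) : Continuous φ :=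
  isOpenQuotientMap_cover.continuous_comp_iff.1 hφ.smooth.continuous

theorem IsTestFunction.hasDerivAt_fst (hφ : IsTestFunction φ) (t : ℝ) (x : Circ) :
    HasDerivAt (fun s => φ (s, x)) (derivT φ (t, x)) t := by
  obtain ⟨y, rfl⟩ := QuotientAddGroup.mk_surjective x
  have h1 : DifferentiableAt ℝ (fun s : ℝ => φ (s, (y : Circ))) t :=
    ((hφ.smooth.differentiable (by simp)).comp
      (differentiable_id.prodMk (differentiable_const y))).differentiableAt
  have h2 : derivT φ (t, (y : Circ)) = deriv (fun s : ℝ => φ (s, (y : Circ))) t := by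
    have := deriv_comp_const_add (fun s : ℝ => φ (s, (y : Circ))) t 0
    rw [add_zero] at this
    exact this
  exact h2 ▸ h1.hasDerivAt

theorem IsTestFunction.hasDerivAt_snd (hφ : IsTestFunction φ) (t y : ℝ) :
    HasDerivAt (fun s : ℝ => φ (t, (s : Circ))) (derivX φ (t, (y : Circ))) y := by
  have h1 : DifferentiableAt ℝ (fun s : ℝ => φ (t, (s : Circ))) y :=
    ((hφ.smooth.differentiable (by simp)).comp
      ((differentiable_const t).prodMk differentiable_id)).differentiableAt
  have h2 : derivX φ (t, (y : Circ)) = deriv (fun s : ℝ => φ (t, (s : Circ))) y := by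
    have := deriv_comp_const_add (fun s : ℝ => φ (t, (s : Circ))) y 0
    rw [add_zero] at this
    simpa only [derivX, AddCircle.coe_add] using this
  exact h2 ▸ h1.hasDerivAt

/-- On the cover the partial derivative is the Fréchet derivative in a fixed direction, hence
smooth; off the support the function is locally zero, so the support does not grow. -/
theorem IsTestFunction.derivT (hφ : IsTestFunction φ) : IsTestFunction (derivT φ) where
  smooth := by
    have h : (fun p : ℝ × ℝ => CylinderAlgebra.derivT φ (p.1, (p.2 : Circ))) = fun p =>
        fderiv ℝ (fun p : ℝ × ℝ => φ (p.1, (p.2 : Circ))) p (1, 0) := by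
      ext p
      have h1 := (hφ.smooth.differentiable (by simp) p).hasFDerivAt.comp_hasDerivAt p.1
        ((hasDerivAt_id p.1).prodMk (hasDerivAt_const p.1 p.2))
      exact (hφ.hasDerivAt_fst p.1 p.2).unique h1
    rw [h]
    exact (hφ.smooth.fderiv_right (by simp)).clm_apply contDiff_const
  compactSupport := by
    refine hφ.compactSupport.mono' fun p hp => ?_
    by_contra hcon
    refine hp ?_
    have h1 : ∀ᶠ q in 𝓝 p, φ q = 0 := notMem_tsupport_iff_eventuallyEq.1 hcon
    have h2 : Tendsto (fun s : ℝ => (p.1 + s, p.2)) (𝓝 0) (𝓝 p) := by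
      have : Continuous fun s : ℝ => (p.1 + s, p.2) := by fun_prop
      simpa using this.tendsto 0
    have h3 : (fun s : ℝ => φ (p.1 + s, p.2)) =ᶠ[𝓝 0] fun _ => 0 := h2.eventually h1
    rw [CylinderAlgebra.derivT, h3.deriv_eq, deriv_const]

theorem IsTestFunction.derivX (hφ : IsTestFunction φ) : IsTestFunction (derivX φ) where
  smooth := by
    have h : (fun p : ℝ × ℝ => CylinderAlgebra.derivX φ (p.1, (p.2 : Circ))) = fun p =>
        fderiv ℝ (fun p : ℝ × ℝ => φ (p.1, (p.2 : Circ))) p (0, 1) := by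
      ext p
      have h1 := (hφ.smooth.differentiable (by simp) p).hasFDerivAt.comp_hasDerivAt p.2
        ((hasDerivAt_const p.2 p.1).prodMk (hasDerivAt_id p.2))
      exact (hφ.hasDerivAt_snd p.1 p.2).unique h1
    rw [h]
    exact (hφ.smooth.fderiv_right (by simp)).clm_apply contDiff_const
  compactSupport := by
    refine hφ.compactSupport.mono' fun p hp => ?_
    by_contra hcon
    refine hp ?_
    have h1 : ∀ᶠ q in 𝓝 p, φ q = 0 := notMem_tsupport_iff_eventuallyEq.1 hcon
    have h2 : Tendsto (fun s : ℝ => (p.1, p.2 + (s : Circ))) (𝓝 0) (𝓝 p) := by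
      have : Continuous fun s : ℝ => (p.1, p.2 + (s : Circ)) :=
        continuous_const.prodMk (continuous_const.add (AddCircle.continuous_mk' _))
      simpa using this.tendsto 0
    have h3 : (fun s : ℝ => φ (p.1, p.2 + (s : Circ))) =ᶠ[𝓝 0] fun _ => 0 := h2.eventually h1
    rw [CylinderAlgebra.derivX, h3.deriv_eq, deriv_const]

theorem IsTestFunction.add {ψ : ℝ × Circ → ℂ} (hφ : IsTestFunction φ) (hψ : IsTestFunction ψ) :
    IsTestFunction (φ + ψ) :=
  ⟨hφ.smooth.add hψ.smooth, hφ.compactSupport.add hψ.compactSupport⟩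

theorem IsTestFunction.lap (hφ : IsTestFunction φ) : IsTestFunction (lap φ) :=
  hφ.derivT.derivT.add hφ.derivX.derivX

/-- The complex conjugate of a function on the cylinder. -/
def conjFun (φ : ℝ × Circ → ℂ) (p : ℝ × Circ) : ℂ := star (φ p)

theorem IsTestFunction.conjFun (hφ : IsTestFunction φ) : IsTestFunction (conjFun φ) :=
  ⟨(conjCLE : ℂ →L[ℝ] ℂ).contDiff.comp hφ.smooth, hφ.compactSupport.comp_left (star_zero ℂ)⟩

theorem derivT_conjFun (φ : ℝ × Circ → ℂ) : derivT (conjFun φ) = conjFun (derivT φ) := by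
  ext p; exact deriv.star

theorem derivX_conjFun (φ : ℝ × Circ → ℂ) : derivX (conjFun φ) = conjFun (derivX φ) := by
  ext p; exact deriv.star

theorem lap_conjFun (φ : ℝ × Circ → ℂ) : lap (conjFun φ) = conjFun (lap φ) := by
  ext p
  simp only [lap, derivT_conjFun, derivX_conjFun]
  simp [conjFun, lap]

/-- The slices of a test function, as a continuous function with values in `L²(𝕊¹)`. -/
def slice (hφ : IsTestFunction φ) (t : ℝ) : L2Circ :=
  ContinuousMap.toLp (E := ℂ) 2 volume ℂ ((ContinuousMap.curry ⟨φ, hφ.continuous⟩) t)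

theorem coeFn_slice (hφ : IsTestFunction φ) (t : ℝ) : ∀ᵐ x, slice hφ t x = φ (t, x) :=
  ContinuousMap.coeFn_toLp (p := 2) (𝕜 := ℂ) (volume : Measure Circ) _

theorem hasCompactSupport_slice (hφ : IsTestFunction φ) : HasCompactSupport (slice hφ) := by
  refine HasCompactSupport.intro (hφ.compactSupport.isCompact.image continuous_fst) fun t ht => ?_
  have : (ContinuousMap.curry ⟨φ, hφ.continuous⟩) t = 0 := by
    ext x
    by_contra hcon
    exact ht ⟨(t, x), subset_tsupport _ hcon, rfl⟩
  rw [slice, this, map_zero]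

theorem memLp_slice (hφ : IsTestFunction φ) : MemLp (slice hφ) 2 (volume : Measure ℝ) :=
  Continuous.memLp_of_hasCompactSupport
    ((ContinuousMap.toLp (E := ℂ) 2 volume ℂ).continuous.comp (ContinuousMap.continuous _))
    (hasCompactSupport_slice hφ)

/-- A test function as an element of `L²(ℝ; L²(𝕊¹))`. -/
def testLp (hφ : IsTestFunction φ) : L2Cyl := (memLp_slice hφ).toLp _

theorem coeFn_testLp (hφ : IsTestFunction φ) : ∀ᵐ t, testLp hφ t = slice hφ t :=
  (memLp_slice hφ).coeFn_toLp

/-- The pairing is bilinear and the inner product conjugate-linear on the left, hence the conjugate.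
Distributional equations thereby become statements about adjoints. -/
theorem pair_eq_inner (u : L2Cyl) (hφ : IsTestFunction φ) :
    pair u φ = inner ℂ (testLp hφ.conjFun) u := by
  rw [pair, L2.inner_def]
  refine integral_congr_ae ?_
  filter_upwards [coeFn_testLp hφ.conjFun] with t ht
  rw [ht, L2.inner_def]
  refine integral_congr_ae ?_
  filter_upwards [coeFn_slice hφ.conjFun t] with x hx
  rw [hx]
  simp [conjFun]

/-- The `j`-th Fourier coefficient on the circle. -/
def coeff (j : ℤ) : L2Circ →L[ℂ] ℂ := innerSL ℂ (circBasis j)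

theorem repr_eq_coeff (v : L2Circ) (j : ℤ) : circBasis.repr v j = coeff j v :=
  circBasis.repr_apply_apply v j

theorem coeff_eq_integral (j : ℤ) (v : L2Circ) :
    coeff j v = (((Real.sqrt (2 * Real.pi))⁻¹ : ℝ) : ℂ) * ∫ x : Circ, fourier (-j) x * v x := by
  rw [coeff, innerSL_apply_apply, circBasis_apply, expLp, inner_smul_left, conj_ofReal, L2.inner_def]
  congr 1
  refine integral_congr_ae ?_
  filter_upwards [ContinuousMap.coeFn_toLp (p := 2) (𝕜 := ℂ) (volume : Measure Circ)
    (fourier j : C(Circ, ℂ))] with x hx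
  rw [hx, fourier_neg]
  simp [mul_comm]

/-- The `j`-th Fourier coefficient of a test function, as a function on the line. -/
def testCoeff (φ : ℝ × Circ → ℂ) (j : ℤ) (t : ℝ) : ℂ :=
  (((Real.sqrt (2 * Real.pi))⁻¹ : ℝ) : ℂ) * ∫ x : Circ, fourier (-j) x * φ (t, x)

theorem coeff_slice (hφ : IsTestFunction φ) (j : ℤ) (t : ℝ) :
    coeff j (slice hφ t) = testCoeff φ j t := by
  rw [coeff_eq_integral, testCoeff]
  congr 1
  refine integral_congr_ae ?_
  filter_upwards [coeFn_slice hφ t] with x hx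
  rw [hx]

/-- Differentiation under the integral: compact support bounds the derivative by a constant, which
is integrable because the circle has finite measure. -/
theorem hasDerivAt_testCoeff (hφ : IsTestFunction φ) (j : ℤ) (t : ℝ) :
    HasDerivAt (testCoeff φ j) (testCoeff (derivT φ) j t) t := by
  obtain ⟨M, hM⟩ := hφ.derivT.compactSupport.exists_bound_of_continuous hφ.derivT.continuous
  have hc {ψ : ℝ × Circ → ℂ} (hψ : IsTestFunction ψ) (s : ℝ) :
      Continuous fun x : Circ => fourier (-j) x * ψ (s, x) :=
    (map_continuous _).mul (hψ.continuous.comp (Continuous.prodMk_right s))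
  have hint {f : Circ → ℂ} (hf : Continuous f) : Integrable f := by
    rw [← integrableOn_univ]
    exact hf.continuousOn.integrableOn_compact isCompact_univ
  refine HasDerivAt.const_mul _ ?_
  refine (hasDerivAt_integral_of_dominated_loc_of_deriv_le (F := fun s x => fourier (-j) x * φ (s, x))
    (F' := fun s x => fourier (-j) x * derivT φ (s, x)) (bound := fun _ => M) (s := Set.univ)
    univ_mem ?_ ?_ ?_ ?_ ?_ ?_).2
  · exact Eventually.of_forall fun s => (hc hφ s).aestronglyMeasurable
  · exact hint (hc hφ t)
  · exact (hc hφ.derivT t).aestronglyMeasurable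
  · refine Eventually.of_forall fun x s _ => ?_
    rw [norm_mul, fourier_apply, Circle.norm_coe, one_mul]
    exact hM _
  · exact integrable_const M
  · exact Eventually.of_forall fun x s _ => (hφ.hasDerivAt_fst s x).const_mul _

theorem contDiff_testCoeff (hφ : IsTestFunction φ) (j : ℤ) : ContDiff ℝ ∞ (testCoeff φ j) := by
  refine contDiff_infty.2 fun n => ?_
  -- The derivative is the coefficient of `derivT φ`, another test function, so `φ` must vary in the
  -- induction.
  induction n generalizing φ with
  | zero =>
    refine contDiff_zero.2 (Differentiable.continuous (𝕜 := ℝ) fun t => ?_)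
    exact (hasDerivAt_testCoeff hφ j t).differentiableAt
  | succ n ih =>
    have h : deriv (testCoeff φ j) = testCoeff (derivT φ) j :=
      funext fun t => (hasDerivAt_testCoeff hφ j t).deriv
    push_cast
    refine contDiff_succ_iff_deriv.2 ⟨fun t => (hasDerivAt_testCoeff hφ j t).differentiableAt,
      by simp, ?_⟩
    rw [h]
    exact ih hφ.derivT

/-- Integration by parts without boundary terms: the integrand in `key` is the derivative of the
periodic function `e^{-ijx} φ(t,x)`. -/
theorem testCoeff_derivX (hφ : IsTestFunction φ) (j : ℤ) (t : ℝ) :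
    testCoeff (derivX φ) j t = (I * j) * testCoeff φ j t := by
  have key : ∫ x : Circ, (fourier (-j) x * derivX φ (t, x) - (I * j) * (fourier (-j) x * φ (t, x)))
      = 0 := by
    rw [← AddCircle.intervalIntegral_preimage (2 * Real.pi) 0]
    have hd (y : ℝ) : HasDerivAt (fun y : ℝ => fourier (-j) (y : Circ) * φ (t, (y : Circ)))
        (fourier (-j) (y : Circ) * derivX φ (t, (y : Circ)) -
          (I * j) * (fourier (-j) (y : Circ) * φ (t, (y : Circ)))) y := by
      convert! (hasDerivAt_fourier (2 * Real.pi) (-j) y).mul (hφ.hasDerivAt_snd t y) using 1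
      have : (Real.pi : ℂ) ≠ 0 := ofReal_ne_zero.2 Real.pi_ne_zero
      push_cast
      field_simp
      ring
    rw [intervalIntegral.integral_eq_sub_of_hasDerivAt (fun y _ => hd y)]
    · rw [zero_add, AddCircle.coe_period, QuotientAddGroup.mk_zero, sub_self]
    · refine Continuous.intervalIntegrable ?_ _ _
      have h1 : Continuous fun y : ℝ => (y : Circ) := AddCircle.continuous_mk' _
      have h2 := hφ.continuous
      have h3 := hφ.derivX.continuous
      fun_prop
  have hint {ψ : ℝ × Circ → ℂ} (hψ : IsTestFunction ψ) :
      Integrable fun x : Circ => fourier (-j) x * ψ (t, x) := by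
    rw [← integrableOn_univ]
    exact ((map_continuous _).mul (hψ.continuous.comp
      (Continuous.prodMk_right t))).continuousOn.integrableOn_compact isCompact_univ
  rw [integral_sub (hint hφ.derivX) ((hint hφ).const_mul _), integral_const_mul, sub_eq_zero] at key
  rw [testCoeff, testCoeff, key]
  ring

theorem hasCompactSupport_testCoeff (hφ : IsTestFunction φ) (j : ℤ) :
    HasCompactSupport (testCoeff φ j) := by
  have := (hasCompactSupport_slice hφ).comp_left (g := coeff j) (map_zero _)
  rwa [show coeff j ∘ slice hφ = testCoeff φ j from funext (coeff_slice hφ j)] at this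

open SchwartzMap LineDeriv

/-- The `j`-th Fourier coefficient of a test function, as a Schwartz function. -/
def testSchwartz (hφ : IsTestFunction φ) (j : ℤ) : 𝓢(ℝ, ℂ) :=
  (hasCompactSupport_testCoeff hφ j).toSchwartzMap (contDiff_testCoeff hφ j)

theorem testSchwartz_apply (hφ : IsTestFunction φ) (j : ℤ) (t : ℝ) :
    testSchwartz hφ j t = testCoeff φ j t := rfl

theorem testSchwartz_derivT (hφ : IsTestFunction φ) (j : ℤ) :
    testSchwartz hφ.derivT j = ∂_{(1 : ℝ)} (testSchwartz hφ j) := by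
  ext t
  rw [SchwartzMap.lineDerivOp_apply_eq_fderiv, fderiv_apply_one_eq_deriv, testSchwartz_apply]
  exact (hasDerivAt_testCoeff hφ j t).deriv.symm

theorem testSchwartz_derivX (hφ : IsTestFunction φ) (j : ℤ) :
    testSchwartz hφ.derivX j = (I * j) • testSchwartz hφ j := by
  ext t
  rw [smul_apply, testSchwartz_apply, testCoeff_derivX hφ]
  rfl

theorem coeff_testLp (hφ : IsTestFunction φ) (j : ℤ) :
    (coeff j).compLp (testLp hφ) = (testSchwartz hφ j).toLp 2 := by
  refine Lp.ext ?_
  filter_upwards [(coeff j).coeFn_compLp (testLp hφ), coeFn_testLp hφ,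
    (testSchwartz hφ j).coeFn_toLp 2 (volume : Measure ℝ)] with t h1 h2 h3
  rw [h1, h2, h3, coeff_slice, testSchwartz_apply]

theorem coeff_fourierL2_symm_testLp (hφ : IsTestFunction φ) (j : ℤ) :
    ∀ᵐ τ : ℝ, coeff j (fourierL2.symm (testLp hφ) τ) =
      fourierL2.symm ((testSchwartz hφ j).toLp 2 (volume : Measure ℝ)) τ := by
  rw [← coeff_testLp, fourierL2_symm_compLp]
  filter_upwards [(coeff j).coeFn_compLp (fourierL2.symm (testLp hφ))] with t h1
  rw [h1]

theorem coeff_fourierL2_symm_derivT (hφ : IsTestFunction φ) (j : ℤ) :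
    ∀ᵐ τ : ℝ, coeff j (fourierL2.symm (testLp hφ.derivT) τ) =
      -(I * τ) * coeff j (fourierL2.symm (testLp hφ) τ) := by
  filter_upwards [coeff_fourierL2_symm_testLp hφ j, coeff_fourierL2_symm_testLp hφ.derivT j,
    fourierL2_symm_deriv (testSchwartz hφ j)] with τ h1 h2 h3
  rw [h2, h1, testSchwartz_derivT hφ, h3]

theorem coeff_fourierL2_symm_derivX (hφ : IsTestFunction φ) (j : ℤ) :
    ∀ᵐ τ : ℝ, coeff j (fourierL2.symm (testLp hφ.derivX) τ) =
      (I * j) * coeff j (fourierL2.symm (testLp hφ) τ) := by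
  have h := Lp.coeFn_smul (I * j : ℂ)
    (fourierL2.symm ((testSchwartz hφ j).toLp 2 (volume : Measure ℝ)))
  filter_upwards [coeff_fourierL2_symm_testLp hφ j, coeff_fourierL2_symm_testLp hφ.derivX j,
    h] with τ h1 h2 h3
  have h4 : ((I * j : ℂ) • testSchwartz hφ j).toLp 2 (volume : Measure ℝ) =
      (I * j : ℂ) • (testSchwartz hφ j).toLp 2 (volume : Measure ℝ) := 
    map_smul (toLpCLM ℂ (E := ℝ) ℂ 2 volume) (I * j : ℂ) (testSchwartz hφ j)
  rw [h2, h1, testSchwartz_derivX hφ, h4, map_smul, h3]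
  rfl

end TestFunctions

/-! ### Separation by test functions -/

section Separation

/-- The test function `(t, x) ↦ χ(t) e^{ijx}`. -/
def prodTest (χ : ℝ → ℂ) (j : ℤ) (p : ℝ × Circ) : ℂ := χ p.1 * fourier j p.2

variable {χ : ℝ → ℂ}

theorem isTestFunction_prodTest (h1 : ContDiff ℝ ∞ χ) (h2 : HasCompactSupport χ) (j : ℤ) :
    IsTestFunction (prodTest χ j) where
  smooth := by
    have : (fun p : ℝ × ℝ => prodTest χ j (p.1, (p.2 : Circ))) = fun p =>
        χ p.1 * cexp (2 * Real.pi * I * j * p.2 / (2 * Real.pi : ℝ)) := by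
      ext p; simp only [prodTest, fourier_coe_apply]
    rw [this]
    have h3 : ContDiff ℝ ∞ fun p : ℝ × ℝ => (p.2 : ℂ) := ofRealCLM.contDiff.comp contDiff_snd
    exact (h1.comp contDiff_fst).mul
      (((contDiff_const.mul h3).div_const _).cexp)
  compactSupport := by
    refine HasCompactSupport.intro (h2.isCompact.prod isCompact_univ) fun p hp => ?_
    have : χ p.1 = 0 := by
      by_contra hcon
      exact hp ⟨subset_tsupport _ hcon, trivial⟩
    rw [prodTest, this, zero_mul]

theorem derivT_prodTest (χ : ℝ → ℂ) (j : ℤ) :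
    derivT (prodTest χ j) = prodTest (deriv χ) j := by
  ext p
  simp only [derivT, prodTest]
  rw [deriv_mul_const_field, deriv_comp_const_add, add_zero]

theorem derivX_prodTest (χ : ℝ → ℂ) (j : ℤ) (p : ℝ × Circ) :
    derivX (prodTest χ j) p = (I * j) * prodTest χ j p := by
  obtain ⟨t, x⟩ := p
  obtain ⟨y, rfl⟩ := QuotientAddGroup.mk_surjective x
  have h := (hasDerivAt_fourier (2 * Real.pi) j y).deriv
  have h2 := deriv_comp_const_add (fun s : ℝ => fourier j (s : Circ)) y 0
  rw [add_zero, h] at h2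
  simp only [derivX, prodTest]
  rw [deriv_const_mul_field]
  simp only [AddCircle.coe_add] at h2
  refine (congrArg (χ t * ·) h2).trans ?_
  have : (Real.pi : ℂ) ≠ 0 := ofReal_ne_zero.2 Real.pi_ne_zero
  push_cast
  field_simp

theorem lap_prodTest (χ : ℝ → ℂ) (j : ℤ) :
    lap (prodTest χ j) = prodTest (fun t => deriv (deriv χ) t - (j : ℂ) ^ 2 * χ t) j := by
  ext p
  have h : derivX (prodTest χ j) = fun p => (I * j) * prodTest χ j p :=
    funext (derivX_prodTest χ j)
  have h2 : derivX (derivX (prodTest χ j)) p = (I * j) * derivX (prodTest χ j) p := by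
    conv_lhs => rw [h]
    simp only [derivX]
    rw [deriv_const_mul_field]
  rw [lap, derivT_prodTest, derivT_prodTest, h2, derivX_prodTest]
  simp only [prodTest]
  linear_combination (χ p.1 * (j : ℂ) ^ 2 * fourier j p.2) * I_sq

/-- The index changes sign because the pairing does not conjugate: integrating against `e^{ijx}`
extracts the coefficient of `e^{-ijx}`. -/
theorem pair_prodTest (u : L2Cyl) (χ : ℝ → ℂ) (j : ℤ) :
    pair u (prodTest χ j) = ((Real.sqrt (2 * Real.pi) : ℝ) : ℂ) * ∫ t, χ t * coeff (-j) (u t) := by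
  rw [pair, ← integral_const_mul]
  refine integral_congr_ae (Eventually.of_forall fun t => ?_)
  simp only [prodTest, coeff_eq_integral, neg_neg]
  have hs : ((Real.sqrt (2 * Real.pi) : ℝ) : ℂ) ≠ 0 :=
    ofReal_ne_zero.2 (Real.sqrt_pos.2 Real.two_pi_pos).ne'
  rw [ofReal_inv, mul_left_comm (χ t), mul_inv_cancel_left₀ hs, ← integral_const_mul]
  refine integral_congr_ae (Eventually.of_forall fun x => ?_)
  simp only
  ring

theorem pair_prodTest_compLp (u : L2Cyl) (χ : ℝ → ℂ) (j : ℤ) :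
    pair u (prodTest χ j) =
      ((Real.sqrt (2 * Real.pi) : ℝ) : ℂ) * ∫ t, χ t * (coeff (-j)).compLp u t := by
  rw [pair_prodTest]
  congr 1
  refine integral_congr_ae ?_
  filter_upwards [(coeff (-j)).coeFn_compLp u] with t ht
  rw [ht]

theorem eq_zero_of_coeff (u : L2Cyl) (h : ∀ j, (coeff j).compLp u = 0) : u = 0 := by
  refine (Lp.eq_zero_iff_ae_eq_zero).2 ?_
  have : ∀ᵐ t, ∀ j, coeff j (u t) = 0 := by
    refine ae_all_iff.2 fun j => ?_
    filter_upwards [(coeff j).coeFn_compLp u, Lp.eq_zero_iff_ae_eq_zero.1 (h j)] with t h1 h2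
    rw [← h1, h2, Pi.zero_apply]
  filter_upwards [this] with t ht
  refine ext_repr circBasis fun j => ?_
  rw [repr_eq_coeff, ht, Pi.zero_apply, map_zero]
  rfl

theorem Lp_eq_zero_of_integral (W : Lp ℂ 2 (volume : Measure ℝ))
    (h : ∀ χ : ℝ → ℂ, ContDiff ℝ ∞ χ → HasCompactSupport χ → ∫ t, χ t * W t = 0) : W = 0 := by
  refine (Lp.eq_zero_iff_ae_eq_zero).2 ?_
  refine ae_eq_zero_of_integral_contDiff_smul_eq_zero
    ((Lp.memLp W).locallyIntegrable (by norm_num)) fun g hg hg' => ?_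
  rw [← h (fun t => (g t : ℂ)) (ofRealCLM.contDiff.comp hg) (hg'.comp_left ofReal_zero)]
  rfl

/-- Test functions separate the points of `L²(ℝ × 𝕊¹)`. -/
theorem eq_zero_of_pair (u : L2Cyl) (h : ∀ φ, IsTestFunction φ → pair u φ = 0) : u = 0 := by
  refine eq_zero_of_coeff u fun j => Lp_eq_zero_of_integral _ fun χ h1 h2 => ?_
  have h3 := h _ (isTestFunction_prodTest h1 h2 (-j))
  rw [pair_prodTest_compLp, neg_neg] at h3
  exact (mul_eq_zero.1 h3).resolve_left
    (ofReal_ne_zero.2 (Real.sqrt_pos.2 Real.two_pi_pos).ne')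

open SchwartzMap LineDeriv

theorem deriv_deriv_mul {f g : ℝ → ℂ} (hf : ContDiff ℝ ∞ f) (hg : ContDiff ℝ ∞ g) (t : ℝ) :
    deriv (deriv (f * g)) t =
      deriv (deriv f) t * g t + 2 * deriv f t * deriv g t + f t * deriv (deriv g) t := by
  have hd {h : ℝ → ℂ} (hh : ContDiff ℝ ∞ h) : Differentiable ℝ h := hh.differentiable (by simp)
  have hdd {h : ℝ → ℂ} (hh : ContDiff ℝ ∞ h) : Differentiable ℝ (deriv h) :=
    (contDiff_infty_iff_deriv.1 hh).2.differentiable (by simp)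
  have h1 : deriv (f * g) = fun s => deriv f s * g s + f s * deriv g s :=
    funext fun s => deriv_mul (hd hf s) (hd hg s)
  have h2 : deriv (fun s => deriv f s * g s + f s * deriv g s) t = _ :=
    (((hdd hf t).hasDerivAt.mul (hd hg t).hasDerivAt).add
      ((hd hf t).hasDerivAt.mul (hdd hg t).hasDerivAt)).deriv
  rw [h1, h2]
  ring

theorem deriv_dilate (η : ℝ → ℂ) (c t : ℝ) :
    deriv (fun s => η (c * s)) t = c * deriv η (c * t) := by
  rw [deriv_comp_mul_left]; simp

/-- Extension of a weak equation from compactly supported test functions to Schwartz functions. -/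
theorem integral_schwartz_eq_zero (W : Lp ℂ 2 (volume : Measure ℝ)) (k : ℂ)
    (h : ∀ χ : ℝ → ℂ, ContDiff ℝ ∞ χ → HasCompactSupport χ →
      ∫ t, star (k * χ t - deriv (deriv χ) t) * W t = 0) (f : 𝓢(ℝ, ℂ)) :
    ∫ t, star (k * f t - ∂_{(1 : ℝ)} (∂_{(1 : ℝ)} f) t) * W t = 0 := by
  have hder (g : 𝓢(ℝ, ℂ)) : ((∂_{(1 : ℝ)} g : 𝓢(ℝ, ℂ)) : ℝ → ℂ) = deriv g := by
    ext y
    rw [SchwartzMap.lineDerivOp_apply_eq_fderiv, fderiv_apply_one_eq_deriv]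
  have hf : ContDiff ℝ ∞ f := f.smooth ⊤
  let B : ContDiffBump (0 : ℝ) := ⟨1, 2, one_pos, one_lt_two⟩
  let η : ℝ → ℂ := fun t => (B t : ℂ)
  have hη : ContDiff ℝ ∞ η := ofRealCLM.contDiff.comp B.contDiff
  have hηc : HasCompactSupport η := B.hasCompactSupport.comp_left ofReal_zero
  have hη1 : ContDiff ℝ ∞ (deriv η) := (contDiff_infty_iff_deriv.1 hη).2
  have hη2 : ContDiff ℝ ∞ (deriv (deriv η)) := (contDiff_infty_iff_deriv.1 hη1).2
  obtain ⟨M0, hM0⟩ := hηc.exists_bound_of_continuous hη.continuous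
  obtain ⟨M1, hM1⟩ := hηc.deriv.exists_bound_of_continuous hη1.continuous
  obtain ⟨M2, hM2⟩ := hηc.deriv.deriv.exists_bound_of_continuous hη2.continuous
  -- The cut-offs `η(c n * t)` tend to `1` pointwise, and each derivative on them costs a factor `c
  -- n`, which tends to zero. The bound `c n ≤ 1` gives a dominating function independent of `n`.
  let c : ℕ → ℝ := fun n => 1 / ((n : ℝ) + 1)
  have hc0 : Tendsto c atTop (𝓝 0) := tendsto_one_div_add_atTop_nhds_zero_nat
  have hcpos (n : ℕ) : 0 < c n := by positivity
  have hc1 (n : ℕ) : c n ≤ 1 := by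
    simp only [c]
    rw [div_le_one (by positivity)]
    linarith [(Nat.cast_nonneg n : (0 : ℝ) ≤ n)]
  let ηn : ℕ → ℝ → ℂ := fun n t => η (c n * t)
  have hηn (n : ℕ) : ContDiff ℝ ∞ (ηn n) := hη.comp (contDiff_const.mul contDiff_id)
  have hηnc (n : ℕ) : HasCompactSupport (ηn n) :=
    hηc.comp_homeomorph (Homeomorph.mulLeft₀ (c n) (hcpos n).ne')
  have d1 (n : ℕ) (t : ℝ) : deriv (ηn n) t = c n * deriv η (c n * t) := deriv_dilate η _ t
  have d2 (n : ℕ) (t : ℝ) : deriv (deriv (ηn n)) t = c n * (c n * deriv (deriv η) (c n * t)) := by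
    rw [show deriv (ηn n) = fun t => (c n : ℂ) * deriv η (c n * t) from funext (d1 n),
      deriv_const_mul_field, deriv_dilate]
  have hint (n : ℕ) : ∫ t, star (k * (f * ηn n) t - deriv (deriv (⇑f * ηn n)) t) * W t = 0 :=
    h _ (hf.mul (hηn n)) ((hηnc n).mul_left)
  let F : ℕ → ℝ → ℂ := fun n t => star (k * (f * ηn n) t - deriv (deriv (⇑f * ηn n)) t) * W t
  have hexp (n : ℕ) (t : ℝ) : F n t = star (k * (f t * η (c n * t)) - (deriv (deriv f) t * η (c n * t)
      + 2 * deriv f t * (c n * deriv η (c n * t)) +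
        f t * (c n * (c n * deriv (deriv η) (c n * t))))) * W t := by
    simp only [F]
    rw [deriv_deriv_mul hf (hηn n), d1, d2]
    rfl
  have hlim : Tendsto (fun n => ∫ t, F n t) atTop
      (𝓝 (∫ t, star (k * f t - ∂_{(1 : ℝ)} (∂_{(1 : ℝ)} f) t) * W t)) := by
    have hL2 (g : 𝓢(ℝ, ℂ)) : Integrable fun t => ‖g t‖ * ‖W t‖ :=
      ((g.memLp 2 (volume : Measure ℝ)).norm).integrable_mul (Lp.memLp W).norm
    refine tendsto_integral_of_dominated_convergence
      (fun t => (‖k‖ * M0 + M2) * (‖f t‖ * ‖W t‖) + M0 * (‖∂_{(1 : ℝ)} (∂_{(1 : ℝ)} f) t‖ * ‖W t‖)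
        + 2 * M1 * (‖∂_{(1 : ℝ)} f t‖ * ‖W t‖)) ?_ ?_ ?_ ?_
    · intro n
      have hs : ContDiff ℝ ∞ (⇑f * ηn n) := hf.mul (hηn n)
      have hs2 : Continuous (deriv (deriv (⇑f * ηn n))) :=
        (contDiff_infty_iff_deriv.1 (contDiff_infty_iff_deriv.1 hs).2).2.continuous
      have hs0 : Continuous (⇑f * ηn n) := hs.continuous
      exact (Continuous.aestronglyMeasurable (by fun_prop)).mul (Lp.aestronglyMeasurable W)
    · exact (((hL2 f).const_mul _).add ((hL2 _).const_mul _)).add ((hL2 _).const_mul _)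
    · intro n
      refine Eventually.of_forall fun t => ?_
      rw [hexp, hder, hder, norm_mul, norm_star]
      have e0 := hM0 (c n * t)
      have e1 := hM1 (c n * t)
      have e2 := hM2 (c n * t)
      have hcn : ‖(c n : ℂ)‖ ≤ 1 := by
        rw [norm_real, Real.norm_of_nonneg (hcpos n).le]; exact hc1 n
      have b1 : ‖(c n : ℂ) * deriv η (c n * t)‖ ≤ M1 := by
        rw [norm_mul]
        exact (mul_le_of_le_one_left (norm_nonneg _) hcn).trans e1
      have b2 : ‖(c n : ℂ) * (c n * deriv (deriv η) (c n * t))‖ ≤ M2 := by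
        rw [norm_mul, norm_mul]
        exact (mul_le_of_le_one_left (by positivity) hcn).trans
          ((mul_le_of_le_one_left (norm_nonneg _) hcn).trans e2)
      calc _ ≤ (‖k‖ * (‖f t‖ * M0) + (‖deriv (deriv f) t‖ * M0 + 2 * ‖deriv f t‖ * M1 +
              ‖f t‖ * M2)) * ‖W t‖ := by
            gcongr
            refine (norm_sub_le _ _).trans (add_le_add ?_ ?_)
            · rw [norm_mul, norm_mul]; gcongr
            · refine (norm_add₃_le).trans ?_
              rw [norm_mul, norm_mul (2 * deriv f t), norm_mul 2, norm_mul (f t), norm_ofNat]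
              gcongr
        _ = _ := by ring
    · refine Eventually.of_forall fun t => ?_
      simp_rw [hexp, hder]
      have ht : Tendsto (fun n => c n * t) atTop (𝓝 0) := by simpa using hc0.mul_const t
      have l0 : Tendsto (fun n => η (c n * t)) atTop (𝓝 1) := by
        have : η 0 = 1 := by
          simp only [η]
          rw [B.one_of_mem_closedBall (by simp [B])]; simp
        rw [← this]
        exact (hη.continuous.tendsto 0).comp ht
      have l1 : Tendsto (fun n => deriv η (c n * t)) atTop (𝓝 (deriv η 0)) :=
        (hη1.continuous.tendsto 0).comp ht
      have l2 : Tendsto (fun n => deriv (deriv η) (c n * t)) atTop (𝓝 (deriv (deriv η) 0)) :=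
        (hη2.continuous.tendsto 0).comp ht
      have lc : Tendsto (fun n => (c n : ℂ)) atTop (𝓝 0) := by
        have := (continuous_ofReal.tendsto 0).comp hc0
        simpa [Function.comp_def] using this
      have := ((((l0.const_mul (f t)).const_mul k).sub (((l0.const_mul (deriv (deriv f) t)).add
        ((lc.mul l1).const_mul (2 * deriv f t))).add ((lc.mul (lc.mul l2)).const_mul (f t)))).star).mul_const (W t)
      simpa using this
  have h0 : (fun n => ∫ t, F n t) = fun _ => 0 := funext hint
  rw [h0] at hlim
  exact tendsto_nhds_unique hlim tendsto_const_nhds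

/-- An `L²` function on the line with `W'' = k W` weakly, `k > 0`, vanishes. -/
theorem eq_zero_of_weak_ode (W : Lp ℂ 2 (volume : Measure ℝ)) (k : ℝ) (hk : 0 < k)
    (h : ∀ χ : ℝ → ℂ, ContDiff ℝ ∞ χ → HasCompactSupport χ →
      ∫ t, (k * χ t - deriv (deriv χ) t) * W t = 0) : W = 0 := by
  have h' := integral_schwartz_eq_zero W k (fun χ h1 h2 => by
    have hs : deriv (deriv fun t => star (χ t)) = fun t => star (deriv (deriv χ) t) := by
      have : deriv (fun t => star (χ t)) = fun t => star (deriv χ t) := funext fun t => deriv.star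
      rw [this]
      exact funext fun t => deriv.star
    have := h (fun t => star (χ t)) ((conjCLE : ℂ →L[ℝ] ℂ).contDiff.comp h1)
      (h2.comp_left (star_zero ℂ))
    rw [hs] at this
    simpa using this)
  suffices hG : fourierL2.symm W = 0 by simpa using hG
  refine Lp_eq_zero_of_integral _ fun χ h1 h2 => ?_
  have hpos (t : ℝ) : (k : ℂ) + (t : ℂ) ^ 2 ≠ 0 := by
    have : 0 < k + t ^ 2 := by positivity
    exact_mod_cast this.ne'
  -- Chosen by inverting the operator on the transform side: there `k - ∂²` is multiplication by `k
  -- + τ²`, so a Schwartz `g` with inverse transform `ψ` makes `(k - ∂²) g` correspond to `star χ`.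
  -- Pairing this with `W` gives the integral of `χ` against `fourierL2.symm W`.
  let ψ : ℝ → ℂ := fun t => star (χ t) * ((k : ℂ) + (t : ℂ) ^ 2)⁻¹
  have hψ : ContDiff ℝ ∞ ψ := by
    refine ((conjCLE : ℂ →L[ℝ] ℂ).contDiff.comp h1).mul (ContDiff.inv ?_ hpos)
    exact contDiff_const.add ((ofRealCLM.contDiff).pow 2)
  have hψc : HasCompactSupport ψ := by
    refine h2.mono' fun t ht => subset_tsupport _ ?_
    intro h0
    exact ht (by simp [ψ, h0])
  let ψS : 𝓢(ℝ, ℂ) := hψc.toSchwartzMap hψ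
  obtain ⟨g, hg⟩ := exists_fourierL2_toLp ψS
  have hg' : fourierL2.symm (g.toLp 2 (volume : Measure ℝ)) = ψS.toLp 2 := by
    rw [LinearIsometryEquiv.symm_apply_eq, hg]
  let q : 𝓢(ℝ, ℂ) := (k : ℂ) • g - ∂_{(1 : ℝ)} (∂_{(1 : ℝ)} g)
  have hq : q.toLp 2 (volume : Measure ℝ) =
      (k : ℂ) • g.toLp 2 (volume : Measure ℝ) - (∂_{(1 : ℝ)} (∂_{(1 : ℝ)} g)).toLp 2 (volume : Measure ℝ) := by
    have e1 := map_sub (toLpCLM ℂ (E := ℝ) ℂ 2 volume) ((k : ℂ) • g) (∂_{(1 : ℝ)} (∂_{(1 : ℝ)} g))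
    rw [map_smul] at e1
    exact e1
  have hin : inner ℂ (q.toLp 2 (volume : Measure ℝ)) W = 0 := by
    rw [L2.inner_def, ← h' g]
    refine integral_congr_ae ?_
    filter_upwards [q.coeFn_toLp 2 (volume : Measure ℝ)] with t ht
    rw [ht]
    simp [q, mul_comm]
  rw [← fourierL2.symm.inner_map_map, L2.inner_def] at hin
  rw [← hin]
  refine integral_congr_ae ?_
  have hq2 : fourierL2.symm (q.toLp 2 (volume : Measure ℝ)) =
      (k : ℂ) • fourierL2.symm (g.toLp 2 (volume : Measure ℝ)) -
        fourierL2.symm ((∂_{(1 : ℝ)} (∂_{(1 : ℝ)} g)).toLp 2 (volume : Measure ℝ)) := by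
    rw [hq, map_sub, map_smul]
  rw [hq2]
  filter_upwards [fourierL2_symm_deriv g, fourierL2_symm_deriv (∂_{(1 : ℝ)} g),
    Lp.coeFn_sub ((k : ℂ) • fourierL2.symm (g.toLp 2 (volume : Measure ℝ)))
      (fourierL2.symm ((∂_{(1 : ℝ)} (∂_{(1 : ℝ)} g)).toLp 2 (volume : Measure ℝ))),
    Lp.coeFn_smul (k : ℂ) (fourierL2.symm (g.toLp 2 (volume : Measure ℝ))),
    hg' ▸ ψS.coeFn_toLp 2 (volume : Measure ℝ)] with t t1 t2 t3 t4 t5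
  rw [t3, Pi.sub_apply, t4, Pi.smul_apply, t2, t1, t5]
  have e : (k : ℂ) • ψS t - -(I * t) * (-(I * t) * ψS t) = star (χ t) := by
    have e1 : ψS t = star (χ t) * ((k : ℂ) + (t : ℂ) ^ 2)⁻¹ := rfl
    have e2 : (k : ℂ) • ψS t - -(I * t) * (-(I * t) * ψS t) = ((k : ℂ) + (t : ℂ) ^ 2) * ψS t := by
      rw [smul_eq_mul]
      linear_combination (-(t : ℂ) ^ 2 * ψS t) * I_sq
    rw [e2, e1, mul_comm, inv_mul_cancel_right₀ (hpos t)]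
  rw [e]
  simp [mul_comm]

/-- The only `w ∈ L²(ℝ × 𝕊¹)` with `Δ w = w` weakly is `w = 0`. -/
theorem eq_zero_of_hasWeakLaplacian_self (w : L2Cyl) (h : HasWeakLaplacian w w) : w = 0 := by
  refine eq_zero_of_coeff w fun j => ?_
  -- Since `∂_x²` acts as `-j²`, the coefficient satisfies `W'' = (1 + j²) W`.
  refine eq_zero_of_weak_ode _ (1 + (j : ℝ) ^ 2) (by positivity) fun χ h1 h2 => ?_
  have h3 := h _ (isTestFunction_prodTest h1 h2 (-j))
  rw [lap_prodTest, pair_prodTest_compLp, pair_prodTest_compLp, neg_neg] at h3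
  have hs : ((Real.sqrt (2 * Real.pi) : ℝ) : ℂ) ≠ 0 :=
    ofReal_ne_zero.2 (Real.sqrt_pos.2 Real.two_pi_pos).ne'
  have h4 := mul_left_cancel₀ hs h3
  generalize (coeff j).compLp w = W at h4 ⊢
  have hs2 : Continuous (deriv (deriv χ)) :=
    (contDiff_infty_iff_deriv.1 (contDiff_infty_iff_deriv.1 h1).2).2.continuous
  have hs0 : Continuous χ := h1.continuous
  have hi {g : ℝ → ℂ} (hg : Continuous g) (hgc : HasCompactSupport g) :
      Integrable fun t => g t * W t :=
    (hg.memLp_of_hasCompactSupport (p := 2) (μ := volume) hgc).integrable_mul (Lp.memLp W)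
  have i1 := hi hs0 h2
  have i2 := hi hs2 h2.deriv.deriv
  have e1 : ∫ t, (deriv (deriv χ) t - ((-j : ℤ) : ℂ) ^ 2 * χ t) * W t =
      (∫ t, deriv (deriv χ) t * W t) - (j : ℂ) ^ 2 * ∫ t, χ t * W t := by
    rw [← integral_const_mul, ← integral_sub i2 (i1.const_mul _)]
    refine integral_congr_ae (Eventually.of_forall fun t => ?_)
    push_cast
    ring
  have e2 : ∫ t, (((1 + (j : ℝ) ^ 2 : ℝ) : ℂ) * χ t - deriv (deriv χ) t) * W t =
      (1 + (j : ℂ) ^ 2) * (∫ t, χ t * W t) - ∫ t, deriv (deriv χ) t * W t := by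
    rw [← integral_const_mul, ← integral_sub (i1.const_mul _) i2]
    refine integral_congr_ae (Eventually.of_forall fun t => ?_)
    push_cast
    ring
  rw [e1] at h4
  rw [e2]
  linear_combination h4

end Separation

/-! ### Symbols -/

section Symbols

/-- Operator-valued symbols. -/
abbrev Symb : Type := ℝ →ᵇ (L2Circ →L[ℂ] L2Circ)

/-- The diagonal symbol with given entries. -/
def diagSymb (h : ℝ →ᵇ (ℤ →ᵇ ℂ)) : Symb :=
  h.comp (diag circBasis) (lipschitzWith_diag circBasis)

theorem diagSymb_apply (h : ℝ →ᵇ (ℤ →ᵇ ℂ)) (τ : ℝ) : diagSymb h τ = diag circBasis (h τ) := rfl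

theorem coeff_diagSymb (h : ℝ →ᵇ (ℤ →ᵇ ℂ)) (τ : ℝ) (v : L2Circ) (j : ℤ) :
    coeff j (diagSymb h τ v) = h τ j * coeff j v := by
  rw [← repr_eq_coeff, ← repr_eq_coeff, diagSymb_apply, repr_diag]

theorem diagSymb_mul (h k : ℝ →ᵇ (ℤ →ᵇ ℂ)) : diagSymb (h * k) = diagSymb h * diagSymb k := by
  ext1 τ; exact map_mul (diag circBasis) (h τ) (k τ)

theorem diagSymb_add (h k : ℝ →ᵇ (ℤ →ᵇ ℂ)) : diagSymb (h + k) = diagSymb h + diagSymb k := by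
  ext1 τ; exact map_add (diag circBasis) (h τ) (k τ)

theorem diagSymb_smul (c : ℂ) (k : ℝ →ᵇ (ℤ →ᵇ ℂ)) : diagSymb (c • k) = c • diagSymb k := by
  ext1 τ; exact map_smul (diag circBasis) c (k τ)

theorem diagSymb_star (h : ℝ →ᵇ (ℤ →ᵇ ℂ)) : diagSymb (star h) = star (diagSymb h) := by
  ext1 τ; exact map_star (diag circBasis) (h τ)

theorem norm_diagSymb_le (h : ℝ →ᵇ (ℤ →ᵇ ℂ)) : ‖diagSymb h‖ ≤ ‖h‖ :=
  (BoundedContinuousFunction.norm_le (norm_nonneg _)).2 fun τ =>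
    (norm_diag_le circBasis (h τ)).trans (h.norm_coe_le_norm τ)

theorem coeff_mulOp_diagSymb (h : ℝ →ᵇ (ℤ →ᵇ ℂ)) (u : L2Cyl) :
    ∀ᵐ τ, ∀ j, coeff j (mulOp volume (diagSymb h) u τ) = h τ j * coeff j (u τ) := by
  filter_upwards [mulOp_apply volume (diagSymb h) u] with τ hτ j
  rw [hτ, coeff_diagSymb]

theorem L2Cyl_ext {u v : L2Cyl} (h : ∀ j, ∀ᵐ τ, coeff j (u τ) = coeff j (v τ)) : u = v := by
  refine Lp.ext ?_
  filter_upwards [ae_all_iff.2 h] with τ hτ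
  refine ext_repr circBasis fun j => ?_
  rw [repr_eq_coeff, repr_eq_coeff, hτ]

/-- A family of uniformly bounded and uniformly Lipschitz functions as a symbol. -/
def mkSymb (h : ℝ → ℤ → ℝ) (C K : NNReal) (hC : ∀ τ j, |h τ j| ≤ C)
    (hK : ∀ τ σ j, |h τ j - h σ j| ≤ K * |τ - σ|) : ℝ →ᵇ (ℤ →ᵇ ℂ) :=
  BoundedContinuousFunction.ofNormedAddCommGroup
    (fun τ => BoundedContinuousFunction.ofNormedAddCommGroup (fun j => (h τ j : ℂ))
      continuous_of_discreteTopology C (fun j => by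
        rw [norm_real]; exact hC τ j))
    (LipschitzWith.continuous (K := K) (LipschitzWith.of_dist_le_mul fun τ σ => by
      rw [dist_eq_norm, Real.dist_eq]
      refine (BoundedContinuousFunction.norm_le (by positivity)).2 fun j => ?_
      have : ‖((h τ j - h σ j : ℝ) : ℂ)‖ ≤ K * |τ - σ| := by rw [norm_real]; exact hK τ σ j
      simpa using this))
    C (fun τ => BoundedContinuousFunction.norm_ofNormedAddCommGroup_le _ C.2 _)

theorem star_mkSymb {h : ℝ → ℤ → ℝ} {C K : NNReal} (hC : ∀ τ j, |h τ j| ≤ C)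
    (hK : ∀ τ σ j, |h τ j - h σ j| ≤ K * |τ - σ|) :
    star (mkSymb h C K hC hK) = mkSymb h C K hC hK := by
  ext τ j
  exact conj_ofReal (h τ j)

/-- `√(1 + τ² + x²)`. -/
def jap (τ x : ℝ) : ℝ := Real.sqrt (1 + τ ^ 2 + x ^ 2)

theorem jap_sq (τ x : ℝ) : jap τ x ^ 2 = 1 + τ ^ 2 + x ^ 2 := Real.sq_sqrt (by positivity)

theorem one_le_jap (τ x : ℝ) : 1 ≤ jap τ x :=
  Real.one_le_sqrt.2 (by nlinarith [sq_nonneg τ, sq_nonneg x])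

theorem jap_pos (τ x : ℝ) : 0 < jap τ x := one_pos.trans_le (one_le_jap τ x)

theorem abs_fst_le_jap (τ x : ℝ) : |τ| ≤ jap τ x :=
  Real.abs_le_sqrt (by nlinarith [sq_nonneg x])

theorem abs_snd_le_jap (τ x : ℝ) : |x| ≤ jap τ x :=
  Real.abs_le_sqrt (by nlinarith [sq_nonneg τ])

/-- `jap τ x` is the Euclidean norm of `(1, τ, x)`; this is its triangle inequality with the
increment measured in the `ℓ¹` norm. -/
theorem jap_le (τ σ x y : ℝ) : jap τ x ≤ jap σ y + (|τ - σ| + |x - y|) := by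
  have h1 := abs_fst_le_jap σ y
  have h2 := abs_snd_le_jap σ y
  refine Real.sqrt_le_iff.2 ⟨add_nonneg (jap_pos _ _).le (by positivity), ?_⟩
  have a1 : τ ^ 2 ≤ (|σ| + |τ - σ|) ^ 2 := by
    rw [← sq_abs τ]
    refine pow_le_pow_left₀ (abs_nonneg _) ?_ 2
    calc |τ| = |σ + (τ - σ)| := by ring_nf
      _ ≤ _ := abs_add_le _ _
  have a2 : x ^ 2 ≤ (|y| + |x - y|) ^ 2 := by
    rw [← sq_abs x]
    refine pow_le_pow_left₀ (abs_nonneg _) ?_ 2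
    calc |x| = |y + (x - y)| := by ring_nf
      _ ≤ _ := abs_add_le _ _
  have h3 := jap_sq σ y
  nlinarith [mul_le_mul_of_nonneg_right h1 (abs_nonneg (τ - σ)),
    mul_le_mul_of_nonneg_right h2 (abs_nonneg (x - y)), sq_abs σ, sq_abs y,
    mul_nonneg (abs_nonneg (τ - σ)) (abs_nonneg (x - y))]

theorem abs_jap_sub_le (τ σ x y : ℝ) : |jap τ x - jap σ y| ≤ |τ - σ| + |x - y| := by
  rw [abs_sub_le_iff]
  have h1 := jap_le τ σ x y
  have h2 := jap_le σ τ y x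
  rw [abs_sub_comm σ, abs_sub_comm y] at h2
  constructor <;> linarith

/-- Both reciprocals are kept on the right: one can absorb a factor `|τ|` or `|x|`, and the other
still supplies decay. With `x = y` this gives continuity in `τ`; with `τ = σ` it gives decay of
commutators. -/
theorem abs_inv_jap_sub_le (τ σ x y : ℝ) :
    |(jap τ x)⁻¹ - (jap σ y)⁻¹| ≤ (|τ - σ| + |x - y|) * ((jap τ x)⁻¹ * (jap σ y)⁻¹) := by
  have h1 := jap_pos τ x
  have h2 := jap_pos σ y
  have : (jap τ x)⁻¹ - (jap σ y)⁻¹ = (jap σ y - jap τ x) * ((jap τ x)⁻¹ * (jap σ y)⁻¹) := by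
    field_simp
  rw [this, abs_mul, abs_of_pos (by positivity : 0 < (jap τ x)⁻¹ * (jap σ y)⁻¹), abs_sub_comm]
  gcongr
  exact abs_jap_sub_le τ σ x y

theorem inv_jap_le_one (τ x : ℝ) : (jap τ x)⁻¹ ≤ 1 := inv_le_one_of_one_le₀ (one_le_jap τ x)

theorem abs_fst_mul_inv_jap_le (τ x : ℝ) : |τ| * (jap τ x)⁻¹ ≤ 1 := by
  rw [← div_eq_mul_inv, div_le_one (jap_pos _ _)]; exact abs_fst_le_jap τ x

theorem abs_snd_mul_inv_jap_le (τ x : ℝ) : |x| * (jap τ x)⁻¹ ≤ 1 := by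
  rw [← div_eq_mul_inv, div_le_one (jap_pos _ _)]; exact abs_snd_le_jap τ x

/-- The Lipschitz constant does not depend on `x`; this uniformity makes the diagonal symbol norm
continuous in `τ`. -/
theorem abs_lam_sub_le (τ σ x : ℝ) :
    |(jap τ x)⁻¹ - (jap σ x)⁻¹| ≤ (1 : NNReal) * |τ - σ| := by
  have h := abs_inv_jap_sub_le τ σ x x
  have h1 := inv_jap_le_one τ x
  have h2 := inv_jap_le_one σ x
  have h3 := (inv_pos.2 (jap_pos τ x)).le
  have h4 := (inv_pos.2 (jap_pos σ x)).le
  rw [sub_self, abs_zero, add_zero] at h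
  refine h.trans ?_
  rw [NNReal.coe_one, one_mul]
  exact mul_le_of_le_one_right (abs_nonneg _) (mul_le_one₀ h1 h4 h2)

theorem abs_tlam_sub_le (τ σ x : ℝ) :
    |-τ * (jap τ x)⁻¹ - -σ * (jap σ x)⁻¹| ≤ (2 : NNReal) * |τ - σ| := by
  have h := abs_inv_jap_sub_le τ σ x x
  have h1 := inv_jap_le_one τ x
  have h2 := abs_fst_mul_inv_jap_le σ x
  have h3 := (inv_pos.2 (jap_pos τ x)).le
  have h4 := (inv_pos.2 (jap_pos σ x)).le
  rw [sub_self, abs_zero, add_zero] at h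
  -- Each summand of this splitting is at most `|τ - σ|` in modulus, whence the constant `2`.
  have e : -τ * (jap τ x)⁻¹ - -σ * (jap σ x)⁻¹ =
      -(τ - σ) * (jap τ x)⁻¹ + -σ * ((jap τ x)⁻¹ - (jap σ x)⁻¹) := by ring
  rw [e]
  refine (abs_add_le _ _).trans ?_
  rw [abs_mul, abs_mul, abs_neg, abs_neg, abs_of_nonneg h3]
  have b1 : |τ - σ| * (jap τ x)⁻¹ ≤ |τ - σ| := mul_le_of_le_one_right (abs_nonneg _) h1
  have b2 : |σ| * |(jap τ x)⁻¹ - (jap σ x)⁻¹| ≤ |τ - σ| := by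
    calc _ ≤ |σ| * (|τ - σ| * ((jap τ x)⁻¹ * (jap σ x)⁻¹)) := by gcongr
      _ = |τ - σ| * ((jap τ x)⁻¹ * (|σ| * (jap σ x)⁻¹)) := by ring
      _ ≤ |τ - σ| := mul_le_of_le_one_right (abs_nonneg _)
          (mul_le_one₀ h1 (by positivity) h2)
  rw [NNReal.coe_ofNat]
  linarith

theorem abs_xlam_sub_le (τ σ x : ℝ) :
    |x * (jap τ x)⁻¹ - x * (jap σ x)⁻¹| ≤ (1 : NNReal) * |τ - σ| := by
  have h := abs_inv_jap_sub_le τ σ x x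
  have h1 := inv_jap_le_one τ x
  have h2 := abs_snd_mul_inv_jap_le σ x
  have h3 := (inv_pos.2 (jap_pos τ x)).le
  have h4 := (inv_pos.2 (jap_pos σ x)).le
  rw [sub_self, abs_zero, add_zero] at h
  rw [← mul_sub, abs_mul, NNReal.coe_one, one_mul]
  calc _ ≤ |x| * (|τ - σ| * ((jap τ x)⁻¹ * (jap σ x)⁻¹)) := by gcongr
    _ = |τ - σ| * ((jap τ x)⁻¹ * (|x| * (jap σ x)⁻¹)) := by ring
    _ ≤ |τ - σ| := mul_le_of_le_one_right (abs_nonneg _)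
        (mul_le_one₀ h1 (by positivity) h2)

/-- The entries `(1 + τ² + j²)^{-1/2}`. -/
def lam : ℝ →ᵇ (ℤ →ᵇ ℂ) := mkSymb (fun τ j => (jap τ j)⁻¹) 1 1
  (fun τ j => by rw [abs_of_pos (inv_pos.2 (jap_pos _ _))]; exact inv_jap_le_one _ _)
  (fun τ σ j => abs_lam_sub_le τ σ j)

/-- The entries `-τ (1 + τ² + j²)^{-1/2}`. -/
def tlam : ℝ →ᵇ (ℤ →ᵇ ℂ) := mkSymb (fun τ j => -τ * (jap τ j)⁻¹) 1 2
  (fun τ j => by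
    rw [abs_mul, abs_neg, abs_of_pos (inv_pos.2 (jap_pos _ _))]; exact abs_fst_mul_inv_jap_le _ _)
  (fun τ σ j => abs_tlam_sub_le τ σ j)

/-- The entries `j (1 + τ² + j²)^{-1/2}`. -/
def xlam : ℝ →ᵇ (ℤ →ᵇ ℂ) := mkSymb (fun τ j => j * (jap τ j)⁻¹) 1 1
  (fun τ j => by
    rw [abs_mul, abs_of_pos (inv_pos.2 (jap_pos _ _))]; exact abs_snd_mul_inv_jap_le _ _)
  (fun τ σ j => abs_xlam_sub_le τ σ j)

theorem lam_apply (τ : ℝ) (j : ℤ) : lam τ j = (((jap τ j)⁻¹ : ℝ) : ℂ) := rfl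

theorem tlam_apply (τ : ℝ) (j : ℤ) : tlam τ j = -τ * lam τ j := by
  change ((-τ * (jap τ j)⁻¹ : ℝ) : ℂ) = _
  rw [lam_apply]; push_cast; ring

theorem xlam_apply (τ : ℝ) (j : ℤ) : xlam τ j = j * lam τ j := by
  change ((j * (jap τ j)⁻¹ : ℝ) : ℂ) = _
  rw [lam_apply]; push_cast; ring

theorem star_lam : star lam = lam := star_mkSymb _ _
theorem star_tlam : star tlam = tlam := star_mkSymb _ _
theorem star_xlam : star xlam = xlam := star_mkSymb _ _

theorem lam_sq (τ : ℝ) (j : ℤ) : lam τ j * lam τ j * (1 + (τ : ℂ) ^ 2 + (j : ℂ) ^ 2) = 1 := by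
  have h : (jap τ j)⁻¹ * (jap τ j)⁻¹ * (1 + τ ^ 2 + (j : ℝ) ^ 2) = 1 := by
    have := jap_pos τ j
    rw [← jap_sq]; field_simp
  rw [lam_apply]
  exact_mod_cast h

/-- The operator of multiplication by a diagonal symbol. -/
def diagOp (h : ℝ →ᵇ (ℤ →ᵇ ℂ)) : L2Cyl →L[ℂ] L2Cyl := mulOp volume (diagSymb h)

theorem inner_diagOp (h : ℝ →ᵇ (ℤ →ᵇ ℂ)) (hh : star h = h) (u v : L2Cyl) :
    inner ℂ (diagOp h u) v = inner ℂ u (diagOp h v) := by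
  have : star (diagOp h) = diagOp h := by rw [diagOp, ← map_star, ← diagSymb_star, hh]
  conv_rhs => rw [← this, ContinuousLinearMap.star_eq_adjoint]
  rw [ContinuousLinearMap.adjoint_inner_right]

theorem coeff_smul_Lp (c : ℂ) (u : L2Cyl) (j : ℤ) :
    ∀ᵐ τ, coeff j ((c • u : L2Cyl) τ) = c * coeff j (u τ) := by
  filter_upwards [Lp.coeFn_smul c u] with τ h
  rw [h, Pi.smul_apply, map_smul, smul_eq_mul]

/-! ### Diagonal symbols on transformed test functions -/

variable {φ : ℝ × Circ → ℂ}

theorem diagOp_lam_derivT (hφ : IsTestFunction φ) :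
    diagOp lam (fourierL2.symm (testLp hφ.derivT)) =
      I • diagOp tlam (fourierL2.symm (testLp hφ)) := by
  refine L2Cyl_ext fun j => ?_
  filter_upwards [coeff_mulOp_diagSymb lam (fourierL2.symm (testLp hφ.derivT)),
    coeff_mulOp_diagSymb tlam (fourierL2.symm (testLp hφ)),
    coeff_smul_Lp I (diagOp tlam (fourierL2.symm (testLp hφ))) j,
    coeff_fourierL2_symm_derivT hφ j] with τ h1 h2 h3 h4
  rw [h3, diagOp, diagOp, h1, h2, h4, tlam_apply]
  ring

theorem diagOp_lam_derivX (hφ : IsTestFunction φ) :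
    diagOp lam (fourierL2.symm (testLp hφ.derivX)) =
      I • diagOp xlam (fourierL2.symm (testLp hφ)) := by
  refine L2Cyl_ext fun j => ?_
  filter_upwards [coeff_mulOp_diagSymb lam (fourierL2.symm (testLp hφ.derivX)),
    coeff_mulOp_diagSymb xlam (fourierL2.symm (testLp hφ)),
    coeff_smul_Lp I (diagOp xlam (fourierL2.symm (testLp hφ))) j,
    coeff_fourierL2_symm_derivX hφ j] with τ h1 h2 h3 h4
  rw [h3, diagOp, diagOp, h1, h2, h4, xlam_apply]
  ring

theorem testLp_add {ψ : ℝ × Circ → ℂ} (hφ : IsTestFunction φ) (hψ : IsTestFunction ψ) :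
    testLp (hφ.add hψ) = testLp hφ + testLp hψ := by
  refine Lp.ext ?_
  filter_upwards [coeFn_testLp (hφ.add hψ), coeFn_testLp hφ, coeFn_testLp hψ,
    Lp.coeFn_add (testLp hφ) (testLp hψ)] with t h1 h2 h3 h4
  rw [h1, h4, Pi.add_apply, h2, h3, slice, slice, slice, ← map_add]
  rfl

theorem testLp_congr {ψ : ℝ × Circ → ℂ} (hφ : IsTestFunction φ) (hψ : IsTestFunction ψ)
    (h : φ = ψ) : testLp hφ = testLp hψ := by subst h; rfl

/-- On each coefficient this reads `λ²·(-τ² - j²) = λ² - 1`, the symbol form of `Λ²Δ = Λ² - 1`. -/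
theorem diagOp_lam_lam_lap (hφ : IsTestFunction φ) :
    diagOp lam (diagOp lam (fourierL2.symm (testLp hφ.lap))) =
      diagOp lam (diagOp lam (fourierL2.symm (testLp hφ))) - fourierL2.symm (testLp hφ) := by
  have e : testLp hφ.lap = testLp hφ.derivT.derivT + testLp hφ.derivX.derivX := testLp_add _ _
  rw [e, map_add]
  refine L2Cyl_ext fun j => ?_
  set w := fourierL2.symm (testLp hφ)
  set a := fourierL2.symm (testLp hφ.derivT.derivT)
  set b := fourierL2.symm (testLp hφ.derivX.derivX)
  filter_upwards [coeff_mulOp_diagSymb lam (a + b),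
    coeff_mulOp_diagSymb lam (diagOp lam (a + b)),
    coeff_mulOp_diagSymb lam w, coeff_mulOp_diagSymb lam (diagOp lam w),
    coeff_fourierL2_symm_derivT hφ j, coeff_fourierL2_symm_derivT hφ.derivT j,
    coeff_fourierL2_symm_derivX hφ j, coeff_fourierL2_symm_derivX hφ.derivX j,
    Lp.coeFn_add a b, Lp.coeFn_sub (diagOp lam (diagOp lam w)) w]
    with τ h1 h2 h3 h4 h5 h6 h7 h8 h9 h10
  rw [h10, Pi.sub_apply, map_sub]
  simp only [diagOp] at h2 h4 ⊢
  rw [h2, h1, h4, h3, h9, Pi.add_apply, map_add, h6, h8, h5, h7]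
  linear_combination (-coeff j (w τ)) * lam_sq τ j +
    (lam τ j * lam τ j * coeff j (w τ) * ((τ : ℂ) ^ 2 + (j : ℂ) ^ 2)) * I_sq

end Symbols

/-! ### The generators -/

section Generators

/-- Conjugation by the Fourier transform. -/
def conjF : (L2Cyl →L[ℂ] L2Cyl) ≃⋆ₐ[ℂ] (L2Cyl →L[ℂ] L2Cyl) :=
  (fourierL2 (E := L2Circ)).conjStarAlgEquiv

theorem conjF_apply (T : L2Cyl →L[ℂ] L2Cyl) (u : L2Cyl) :
    conjF T u = fourierL2 (T (fourierL2.symm u)) := rfl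

theorem inner_conjF_diagOp (h : ℝ →ᵇ (ℤ →ᵇ ℂ)) (hh : star h = h) (u v : L2Cyl) :
    inner ℂ u (conjF (diagOp h) v) =
      inner ℂ (diagOp h (fourierL2.symm u)) (fourierL2.symm v) := by
  rw [inner_diagOp h hh, ← fourierL2.symm.inner_map_map, conjF_apply,
    LinearIsometryEquiv.symm_apply_apply]

theorem pair_sub (u v : L2Cyl) {φ : ℝ × Circ → ℂ} (hφ : IsTestFunction φ) :
    pair (u - v) φ = pair u φ - pair v φ := by
  rw [pair_eq_inner _ hφ, pair_eq_inner _ hφ, pair_eq_inner _ hφ, inner_sub_right]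

/-- Self-adjointness moves the diagonal operators onto the test function, where the derivative is
explicit. Taking `I` out of the left slot of the inner product conjugates it, which accounts for the
minus sign of the weak derivative. -/
theorem hasWeakDerivT_conjF (u : L2Cyl) :
    HasWeakDerivT (conjF (diagOp lam) u) (I • conjF (diagOp tlam) u) := by
  intro φ hφ
  rw [pair_eq_inner _ hφ, pair_eq_inner _ hφ.derivT, inner_smul_right,
    inner_conjF_diagOp _ star_tlam, inner_conjF_diagOp _ star_lam,
    testLp_congr hφ.derivT.conjFun hφ.conjFun.derivT (derivT_conjFun φ).symm,
    diagOp_lam_derivT hφ.conjFun, inner_smul_left, conj_I]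
  ring

theorem hasWeakDerivX_conjF (u : L2Cyl) :
    HasWeakDerivX (conjF (diagOp lam) u) (I • conjF (diagOp xlam) u) := by
  intro φ hφ
  rw [pair_eq_inner _ hφ, pair_eq_inner _ hφ.derivX, inner_smul_right,
    inner_conjF_diagOp _ star_xlam, inner_conjF_diagOp _ star_lam,
    testLp_congr hφ.derivX.conjFun hφ.conjFun.derivX (derivX_conjFun φ).symm,
    diagOp_lam_derivX hφ.conjFun, inner_smul_left, conj_I]
  ring

theorem HasWeakDerivT.unique {u g g' : L2Cyl} (h : HasWeakDerivT u g) (h' : HasWeakDerivT u g') :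
    g = g' :=
  sub_eq_zero.1 (eq_zero_of_pair _ fun φ hφ => by
    rw [pair_sub _ _ hφ, h φ hφ, h' φ hφ, sub_self])

theorem HasWeakDerivX.unique {u g g' : L2Cyl} (h : HasWeakDerivX u g) (h' : HasWeakDerivX u g') :
    g = g' :=
  sub_eq_zero.1 (eq_zero_of_pair _ fun φ hφ => by
    rw [pair_sub _ _ hφ, h φ hφ, h' φ hφ, sub_self])

theorem hasWeakLaplacian_conjF (u : L2Cyl) :
    HasWeakLaplacian (conjF (diagOp lam) (conjF (diagOp lam) u))
      (conjF (diagOp lam) (conjF (diagOp lam) u) - u) := by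
  intro φ hφ
  have key (w : L2Cyl) : inner ℂ w (conjF (diagOp lam) (conjF (diagOp lam) u)) =
      inner ℂ (diagOp lam (diagOp lam (fourierL2.symm w))) (fourierL2.symm u) := by
    rw [inner_conjF_diagOp _ star_lam, conjF_apply, LinearIsometryEquiv.symm_apply_apply,
      inner_diagOp _ star_lam, inner_diagOp _ star_lam, inner_diagOp _ star_lam]
  rw [pair_sub _ _ hφ, pair_eq_inner _ hφ, pair_eq_inner _ hφ, pair_eq_inner _ hφ.lap, key, key,
    testLp_congr hφ.lap.conjFun hφ.conjFun.lap (lap_conjFun φ).symm, diagOp_lam_lam_lap hφ.conjFun,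
    inner_sub_left,
    (fourierL2 (E := L2Circ)).symm.inner_map_map (testLp hφ.conjFun) u]

/-- The difference `w = v - v'` satisfies `Δw = w`, and `L²` contains no such `w` except zero. -/
theorem HasWeakLaplacian.unique {u v v' : L2Cyl} (h : HasWeakLaplacian v (v - u))
    (h' : HasWeakLaplacian v' (v' - u)) : v = v' := by
  refine sub_eq_zero.1 (eq_zero_of_hasWeakLaplacian_self _ fun φ hφ => ?_)
  have h1 := h φ hφ
  have h2 := h' φ hφ
  rw [pair_sub _ _ hφ] at h1 h2
  rw [pair_sub _ _ hφ, pair_sub _ _ hφ.lap, ← h1, ← h2]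
  ring

/-- Uniqueness of the positive square root. -/
theorem _root_.ContinuousLinearMap.IsPositive.eq_of_mul_self_eq {H : Type*} [NormedAddCommGroup H]
    [InnerProductSpace ℂ H] [CompleteSpace H] {S T : H →L[ℂ] H} (hS : S.IsPositive)
    (hT : T.IsPositive) (h : S * S = T * T) : S = T :=
  (CFC.mul_self_eq_mul_self_iff S T ((ContinuousLinearMap.nonneg_iff_isPositive _).2 hS)
    ((ContinuousLinearMap.nonneg_iff_isPositive _).2 hT)).1 h

open scoped ComplexOrder in
theorem isPositive_conjF_lam : (conjF (diagOp lam)).IsPositive := by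
  refine ContinuousLinearMap.isPositive_def'.2 ⟨?_, fun u => ?_⟩
  · rw [IsSelfAdjoint, ← map_star, diagOp, ← map_star, ← diagSymb_star, star_lam]
  · have h : 0 ≤ inner ℂ u (conjF (diagOp lam) u) := by
      rw [inner_conjF_diagOp _ star_lam, inner_diagOp _ star_lam, L2.inner_def]
      refine integral_nonneg_of_ae ?_
      filter_upwards [mulOp_apply volume (diagSymb lam) (fourierL2.symm u)] with t ht
      rw [diagOp, ht, diagSymb_apply]
      refine inner_diag_nonneg _ _ (fun i => ?_) _
      rw [lam_apply]
      exact zero_le_real.2 (inv_pos.2 (jap_pos _ _)).le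
    rw [ContinuousLinearMap.reApplyInnerSelf_apply, inner_re_symm]
    exact (Complex.nonneg_iff.1 h).1

theorem isLambda_conjF_lam : IsLambda (conjF (diagOp lam)) :=
  ⟨isPositive_conjF_lam, fun u _ =>
    ⟨fun h => h ▸ hasWeakLaplacian_conjF u, fun h => (hasWeakLaplacian_conjF u).unique h⟩⟩

/-- The operator `Λ` exists and is unique. -/
theorem isLambda_iff (T : L2Cyl →L[ℂ] L2Cyl) : IsLambda T ↔ T = conjF (diagOp lam) := by
  refine ⟨fun h => ?_, fun h => h ▸ isLambda_conjF_lam⟩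
  -- The defining property of `T` determines its square: `T (T u)` is any `v` with `v - Δv = u`, and
  -- the diagonal candidate supplies one. Positivity then determines `T`.
  have h2 : T * T = conjF (diagOp lam) * conjF (diagOp lam) := by
    ext1 u
    exact (h.2 u _).2 (hasWeakLaplacian_conjF u)
  exact h.1.eq_of_mul_self_eq isPositive_conjF_lam h2

theorem one_div_I_smul_I_smul (u : L2Cyl) : (1 / I) • I • u = u := by
  rw [smul_smul, one_div, inv_mul_cancel₀ I_ne_zero, one_smul]

/-- An operator acting only in the circle variable commutes with the Fourier transform in the other
variable. -/
theorem conjF_const (A : L2Circ →L[ℂ] L2Circ) :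
    conjF (mulOp volume (BoundedContinuousFunction.const ℝ A)) =
      mulOp volume (BoundedContinuousFunction.const ℝ A) := by
  have h (u : L2Cyl) : mulOp volume (BoundedContinuousFunction.const ℝ A) u = A.compLp u := by
    refine Lp.ext ?_
    filter_upwards [mulOp_apply volume (BoundedContinuousFunction.const ℝ A) u,
      A.coeFn_compLp u] with t h1 h2
    rw [h1, h2]; rfl
  ext1 u
  rw [conjF_apply, h, h, fourierL2_compLp, LinearIsometryEquiv.apply_symm_apply]

/-- The symbols of the generators. -/
def symbGenerators : Set Symb :=
  {f | ∃ a : C(Circ, ℂ), SmoothOnCirc a ∧ f = BoundedContinuousFunction.const ℝ (circMul a)} ∪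
    {diagSymb lam, diagSymb tlam, diagSymb xlam}

/-- The last three families in `generators` are singletons, by uniqueness of `Λ` and of weak
derivatives. -/
theorem generators_eq : generators = (fun f => conjF (mulOp volume f)) '' symbGenerators := by
  have h1 : {T : L2Cyl →L[ℂ] L2Cyl | ∃ a : C(Circ, ℂ), SmoothOnCirc a ∧ T = mulCirc a} =
      (fun f => conjF (mulOp volume f)) '' {f | ∃ a : C(Circ, ℂ), SmoothOnCirc a ∧
        f = BoundedContinuousFunction.const ℝ (circMul a)} := by
    ext T
    constructor
    · rintro ⟨a, ha, rfl⟩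
      exact ⟨_, ⟨a, ha, rfl⟩, conjF_const _⟩
    · rintro ⟨_, ⟨a, ha, rfl⟩, rfl⟩
      exact ⟨a, ha, conjF_const _⟩
  have h2 : {T : L2Cyl →L[ℂ] L2Cyl | IsLambda T} = {conjF (diagOp lam)} := by
    ext T; exact isLambda_iff T
  have h3 : {T : L2Cyl →L[ℂ] L2Cyl | ∃ Λ, IsLambda Λ ∧ ∀ u, ∃ g, HasWeakDerivT (Λ u) g ∧
      T u = (1 / I) • g} = {conjF (diagOp tlam)} := by
    ext T
    constructor
    · rintro ⟨Λ, hΛ, hT⟩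
      rw [isLambda_iff] at hΛ
      subst hΛ
      refine ContinuousLinearMap.ext fun u => ?_
      obtain ⟨g, hg, hTg⟩ := hT u
      rw [hTg, hg.unique (hasWeakDerivT_conjF u), one_div_I_smul_I_smul]
    · rintro rfl
      exact ⟨_, isLambda_conjF_lam, fun u =>
        ⟨_, hasWeakDerivT_conjF u, (one_div_I_smul_I_smul _).symm⟩⟩
  have h4 : {T : L2Cyl →L[ℂ] L2Cyl | ∃ Λ, IsLambda Λ ∧ ∀ u, ∃ g, HasWeakDerivX (Λ u) g ∧
      T u = (1 / I) • g} = {conjF (diagOp xlam)} := by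
    ext T
    constructor
    · rintro ⟨Λ, hΛ, hT⟩
      rw [isLambda_iff] at hΛ
      subst hΛ
      refine ContinuousLinearMap.ext fun u => ?_
      obtain ⟨g, hg, hTg⟩ := hT u
      rw [hTg, hg.unique (hasWeakDerivX_conjF u), one_div_I_smul_I_smul]
    · rintro rfl
      exact ⟨_, isLambda_conjF_lam, fun u =>
        ⟨_, hasWeakDerivX_conjF u, (one_div_I_smul_I_smul _).symm⟩⟩
  rw [generators, h1, h2, h3, h4, symbGenerators, Set.image_union, Set.image_insert_eq,
    Set.image_insert_eq, Set.image_singleton, Set.union_assoc, Set.union_assoc]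
  rfl

end Generators

/-! ### Commutation modulo a closed ideal -/

section EssentialCommutant

variable {A : Type*} [CStarAlgebra A]

/-- The elements that commute with all elements of `X` modulo the ideal `J`. -/
def essCommutant (J : TwoSidedIdeal A) (X : Set A) : Subalgebra ℂ A where
  carrier := {y | ∀ x ∈ X, x * y - y * x ∈ J}
  mul_mem' {y z} hy hz x hx := by
    have : x * (y * z) - y * z * x = (x * y - y * x) * z + y * (x * z - z * x) := by
      noncomm_ring
    rw [this]
    exact J.add_mem (J.mul_mem_right _ _ (hy x hx)) (J.mul_mem_left _ _ (hz x hx))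
  add_mem' {y z} hy hz x hx := by
    have : x * (y + z) - (y + z) * x = (x * y - y * x) + (x * z - z * x) := by
      noncomm_ring
    rw [this]
    exact J.add_mem (hy x hx) (hz x hx)
  algebraMap_mem' c x _ := by
    rw [Algebra.commutes, sub_self]
    exact J.zero_mem

theorem mem_essCommutant {J : TwoSidedIdeal A} {X : Set A} {y : A} :
    y ∈ essCommutant J X ↔ ∀ x ∈ X, x * y - y * x ∈ J := Iff.rfl

theorem isClosed_essCommutant {J : TwoSidedIdeal A} (hJ : IsClosed (J : Set A)) (X : Set A) :
    IsClosed (essCommutant J X : Set A) := by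
  have : (essCommutant J X : Set A) = ⋂ x ∈ X, (fun y => x * y - y * x) ⁻¹' (J : Set A) := by
    ext y
    simp only [SetLike.mem_coe, mem_essCommutant, Set.mem_iInter, Set.mem_preimage]
  rw [this]
  exact isClosed_biInter fun x _ => hJ.preimage (by fun_prop)

theorem symm_essCommutant {J : TwoSidedIdeal A} {X Y : Set A} (h : X ⊆ essCommutant J Y) :
    Y ⊆ essCommutant J X := by
  intro y hy x hx
  have := J.neg_mem (h hx y hy)
  rwa [neg_sub] at this

/-- For self-adjoint `G` the generated star algebra is the plain algebra generated by `G`, so `Z`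
need not be closed under `star`. -/
theorem topologicalClosure_adjoin_subset {G : Set A} (hG : star G ⊆ G) {Z : Subalgebra ℂ A}
    (hZ : IsClosed (Z : Set A)) (h : G ⊆ Z) :
    ((StarAlgebra.adjoin ℂ G).topologicalClosure : Set A) ⊆ Z := by
  refine closure_minimal ?_ hZ
  have : (StarAlgebra.adjoin ℂ G).toSubalgebra ≤ Z := by
    rw [StarAlgebra.adjoin_toSubalgebra]
    exact Algebra.adjoin_le (Set.union_subset h (hG.trans h))
  exact this

/-- A double commutant argument modulo `J`: the closed algebra commutes with `G`, hence by symmetry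
`G` commutes with the closed algebra, hence so does everything that `G` generates. -/
theorem commutator_mem_of_generators {J : TwoSidedIdeal A} (hJ : IsClosed (J : Set A))
    {G : Set A} (hG : star G ⊆ G) (h : ∀ x ∈ G, ∀ y ∈ G, x * y - y * x ∈ J) {f g : A}
    (hf : f ∈ (StarAlgebra.adjoin ℂ G).topologicalClosure)
    (hg : g ∈ (StarAlgebra.adjoin ℂ G).topologicalClosure) : f * g - g * f ∈ J := by
  have h1 := topologicalClosure_adjoin_subset hG (isClosed_essCommutant hJ G)
    fun y hy x hx => h x hx y hy
  have h2 := topologicalClosure_adjoin_subset hG (isClosed_essCommutant hJ _)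
    (symm_essCommutant h1)
  exact h2 hg f hf

theorem commutator_mem_of_span_dense {V : Type*} [SeminormedAddCommGroup V] [NormedSpace ℂ V]
    {J : TwoSidedIdeal A} (hJ : IsClosed (J : Set A)) (ℓ : V →L[ℂ] A) {S : Set V}
    (hS : Dense (Submodule.span ℂ S : Set V)) {d : A} (h : ∀ s ∈ S, ℓ s * d - d * ℓ s ∈ J)
    (v : V) : ℓ v * d - d * ℓ v ∈ J := by
  have hle : Submodule.span ℂ S ≤
      (Subalgebra.toSubmodule (essCommutant J {d})).comap ℓ.toLinearMap := by
    rw [Submodule.span_le]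
    rintro s hs x rfl
    have := J.neg_mem (h s hs)
    rwa [neg_sub] at this
  have hv : v ∈ ℓ ⁻¹' (essCommutant J {d} : Set A) :=
    closure_minimal hle ((isClosed_essCommutant hJ _).preimage ℓ.continuous) (hS v)
  have := J.neg_mem (hv d rfl)
  rwa [neg_sub] at this

theorem commutator_swap_mem {J : TwoSidedIdeal A} {x y : A} (h : x * y - y * x ∈ J) :
    y * x - x * y ∈ J := by
  have := J.neg_mem h
  rwa [neg_sub] at this

end EssentialCommutant

/-! ### The algebra of symbols -/

section SymbolAlgebra

/-! Instances that are found faster for a general C*-algebra than for `Symb`. -/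

abbrev cstarRing (A : Type*) [CStarAlgebra A] : Ring A := inferInstance

abbrev cstarNormedRing (A : Type*) [CStarAlgebra A] : NormedRing A := inferInstance

abbrev cstarAddGroup (A : Type*) [CStarAlgebra A] : AddGroup A := inferInstance

abbrev cstarNonUnitalNonAssocRing (A : Type*) [CStarAlgebra A] : NonUnitalNonAssocRing A :=
  inferInstance

theorem cstar_isTopologicalRing (A : Type*) [CStarAlgebra A] : IsTopologicalRing A :=
  inferInstance

theorem cstar_continuousStar (A : Type*) [CStarAlgebra A] : ContinuousStar A := inferInstance

instance : Ring Symb := cstarRing Symb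
instance : NormedRing Symb := cstarNormedRing Symb
instance : AddGroup Symb := cstarAddGroup Symb
instance : NonUnitalNonAssocRing Symb := cstarNonUnitalNonAssocRing Symb
instance : IsTopologicalRing Symb := cstar_isTopologicalRing Symb
instance : ContinuousStar Symb := cstar_continuousStar Symb

/-- Testing on a constant vector cut off to balls gives `f t v = 0` almost everywhere; continuity of
`f` makes it everywhere. -/
theorem mulOp_injective : Function.Injective (mulOp (E := L2Circ) (volume : Measure ℝ)) := by
  refine (injective_iff_map_eq_zero _).2 fun f hf => ?_
  ext1 t
  refine ContinuousLinearMap.ext fun v => ?_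
  have h1 : ∀ᵐ t, f t v = 0 := by
    have h2 (n : ℕ) : ∀ᵐ t : ℝ, t ∈ Metric.ball (0 : ℝ) n → f t v = 0 := by
      have hm : MeasurableSet (Metric.ball (0 : ℝ) n) := measurableSet_ball
      have hfin : volume (Metric.ball (0 : ℝ) n) ≠ ⊤ := measure_ball_lt_top.ne
      filter_upwards [mulOp_apply volume f (indicatorConstLp 2 hm hfin v),
        Lp.coeFn_zero L2Circ 2 (volume : Measure ℝ),
        indicatorConstLp_coeFn_mem (p := 2) (hs := hm) (hμs := hfin) (c := v)] with t h3 h4 h5 ht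
      rw [h5 ht, hf] at h3
      rw [← h3]
      exact h4
    filter_upwards [ae_all_iff.2 h2] with t ht
    obtain ⟨n, hn⟩ := exists_nat_gt ‖t‖
    exact ht n (by simpa using hn)
  have h2 : (fun t => f t v) = fun _ => 0 :=
    (Continuous.ae_eq_iff_eq volume (by fun_prop) continuous_const).1 h1
  exact congrFun h2 t

/-- Injective `*`-homomorphisms of C*-algebras are isometric. Closed sets of symbols thus correspond
to closed sets of operators. -/
theorem isometry_mulOp : Isometry (mulOp (E := L2Circ) (volume : Measure ℝ)) :=
  NonUnitalStarAlgHom.isometry _ mulOp_injective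

/-- The closed algebra generated by the symbols of the generators. -/
def Bsymb : StarSubalgebra ℂ Symb := (StarAlgebra.adjoin ℂ symbGenerators).topologicalClosure

theorem isClosed_Bsymb : IsClosed (Bsymb : Set Symb) :=
  StarSubalgebra.isClosed_topologicalClosure _

theorem symbGenerators_subset : symbGenerators ⊆ (Bsymb : Set Symb) :=
  (StarAlgebra.subset_adjoin ℂ _).trans (StarSubalgebra.le_topologicalClosure _)

/-- The representation `f ↦ F f(M) F⁻¹`. -/
def symbRep : Symb →⋆ₐ[ℂ] (L2Cyl →L[ℂ] L2Cyl) :=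
  (conjF : (L2Cyl →L[ℂ] L2Cyl) →⋆ₐ[ℂ] (L2Cyl →L[ℂ] L2Cyl)).comp (mulOp volume)

theorem isClosedEmbedding_symbRep : IsClosedEmbedding symbRep :=
  (NonUnitalStarAlgHom.isometry symbRep
    (conjF.injective.comp mulOp_injective)).isClosedEmbedding

theorem Adagger_eq : Adagger = Bsymb.map symbRep := by
  have h : StarAlgebra.adjoin ℂ generators = (StarAlgebra.adjoin ℂ symbGenerators).map symbRep := by
    rw [StarAlgHom.map_adjoin, generators_eq]
    rfl
  rw [Adagger, h, Bsymb]
  exact SetLike.coe_injective (isClosedEmbedding_symbRep.closure_image_eq _)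

/-- The conjugation defining `ℬ†` undoes the one in `symbRep`, leaving exactly the multiplication
operators with symbol in `Bsymb`. -/
theorem mem_Bdagger (T : L2Cyl →L[ℂ] L2Cyl) :
    T ∈ Bdagger ↔ ∃ f ∈ Bsymb, mulOp volume f = T := by
  rw [Bdagger, Adagger_eq, StarSubalgebra.map_map, StarSubalgebra.mem_map]
  have h (f : Symb) : ((fourierL2 (E := L2Circ)).symm.conjStarAlgEquiv :
      (L2Cyl →L[ℂ] L2Cyl) →⋆ₐ[ℂ] (L2Cyl →L[ℂ] L2Cyl)).comp symbRep f = mulOp volume f :=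
    conjF.symm_apply_apply (mulOp volume f)
  simp only [h]

/-! ### The ideal `C₀(ℝ, K)` -/

/-- The symbols in `C₀(ℝ, K(L²(𝕊¹)))`. -/
def compactSymb : Set Symb :=
  {f | (∀ t, IsCompactOperator (f t)) ∧ Tendsto f (cocompact ℝ) (𝓝 0)}

theorem range_mulC0 : Set.range mulC0 = mulOp (E := L2Circ) (volume : Measure ℝ) '' compactSymb := by
  ext T
  constructor
  · rintro ⟨f, rfl⟩
    have hf (t : ℝ) : IsCompactOperator (f t : L2Circ →L[ℂ] L2Circ) := (f t).2
    refine ⟨_, ⟨hf, ?_⟩, rfl⟩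
    exact (continuous_subtype_val.tendsto (0 : KCirc)).comp (zero_at_infty f)
  · rintro ⟨f, ⟨h1, h2⟩, rfl⟩
    refine ⟨⟨⟨fun t => ⟨f t, h1 t⟩, f.continuous.subtype_mk _⟩, ?_⟩, rfl⟩
    exact tendsto_subtype_rng.2 h2

theorem isClosed_compactSymb : IsClosed compactSymb := by
  have h : compactSymb = (⋂ t, (fun f : Symb => f t) ⁻¹' (KCirc : Set (L2Circ →L[ℂ] L2Circ))) ∩
      Set.range (ZeroAtInftyContinuousMap.toBCF : C₀(ℝ, L2Circ →L[ℂ] L2Circ) → Symb) := by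
    ext f
    simp only [compactSymb, Set.mem_ofPred_eq, Set.mem_inter_iff, Set.mem_iInter, Set.mem_preimage]
    refine and_congr Iff.rfl ⟨fun h => ⟨⟨f.toContinuousMap, h⟩, rfl⟩, ?_⟩
    rintro ⟨g, rfl⟩
    exact zero_at_infty g
  rw [h]
  refine (isClosed_iInter fun t => IsClosed.preimage ?_ ?_).inter
    (ZeroAtInftyContinuousMap.isClosed_range_toBCF)
  · exact continuous_eval_const t
  · exact isClosed_setOfPred_isCompactOperator

theorem zero_mem_compactSymb : (0 : Symb) ∈ compactSymb :=
  ⟨fun _ => isCompactOperator_zero, tendsto_const_nhds⟩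

theorem add_mem_compactSymb {f g : Symb} (hf : f ∈ compactSymb) (hg : g ∈ compactSymb) :
    f + g ∈ compactSymb :=
  ⟨fun t => (hf.1 t).add (hg.1 t), by have := hf.2.add hg.2; rwa [add_zero] at this⟩

theorem neg_mem_compactSymb {f : Symb} (hf : f ∈ compactSymb) : -f ∈ compactSymb :=
  ⟨fun t => (hf.1 t).neg, by have := hf.2.neg; rwa [neg_zero] at this⟩

theorem mul_mem_compactSymb_left (b : Symb) {f : Symb} (hf : f ∈ compactSymb) :
    b * f ∈ compactSymb := by
  refine ⟨fun t => (hf.1 t).clm_comp (b t), ?_⟩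
  refine squeeze_zero_norm (a := fun t => ‖b‖ * ‖f t‖) (fun t => ?_)
    (by simpa using hf.2.norm.const_mul ‖b‖)
  exact (norm_mul_le _ _).trans (by gcongr; exact b.norm_coe_le_norm t)

theorem mul_mem_compactSymb_right (b : Symb) {f : Symb} (hf : f ∈ compactSymb) :
    f * b ∈ compactSymb := by
  refine ⟨fun t => (hf.1 t).comp_clm (b t), ?_⟩
  refine squeeze_zero_norm (a := fun t => ‖f t‖ * ‖b‖) (fun t => ?_)
    (by simpa using hf.2.norm.mul_const ‖b‖)
  exact (norm_mul_le _ _).trans (by gcongr; exact b.norm_coe_le_norm t)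

/-- `C₀(ℝ, K(L²(𝕊¹)))` as an ideal of the algebra of symbols. -/
def compactIdeal : TwoSidedIdeal Symb :=
  TwoSidedIdeal.mk' compactSymb zero_mem_compactSymb add_mem_compactSymb neg_mem_compactSymb
    (fun {x _} => mul_mem_compactSymb_left x) (fun {_ y} => mul_mem_compactSymb_right y)

theorem mem_compactIdeal {f : Symb} : f ∈ compactIdeal ↔ f ∈ compactSymb :=
  TwoSidedIdeal.mem_mk' _ _ _ _ _ _ _

theorem isClosed_compactIdeal : IsClosed (compactIdeal : Set Symb) := by
  rw [show (compactIdeal : Set Symb) = compactSymb from Set.ext fun _ => mem_compactIdeal]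
  exact isClosed_compactSymb

theorem star_symbGenerators : star symbGenerators ⊆ symbGenerators := by
  rintro f hf
  rw [Set.mem_star] at hf
  rw [← star_star f]
  generalize star f = g at hf
  rcases hf with ⟨a, ha, rfl⟩ | rfl | rfl | rfl
  · refine Or.inl ⟨star a, (conjCLE : ℂ →L[ℝ] ℂ).contDiff.comp ha, ?_⟩
    ext1 t
    exact star_circMul a
  · rw [← diagSymb_star, star_lam]; exact Or.inr (Or.inl rfl)
  · rw [← diagSymb_star, star_tlam]; exact Or.inr (Or.inr (Or.inl rfl))
  · rw [← diagSymb_star, star_xlam]; exact Or.inr (Or.inr (Or.inr rfl))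

end SymbolAlgebra

/-! ### Commutators of the generators -/

section Commutators

/-- The shift of a sequence. -/
def shiftSeq (k : ℤ) (a : ℤ →ᵇ ℂ) : ℤ →ᵇ ℂ :=
  a.compContinuous ⟨fun j => j + k, continuous_of_discreteTopology⟩

/-- Moving a diagonal operator past a shift shifts its entries, so only differences of entries at
distance `k` survive. -/
theorem commutator_fourier_diag (k : ℤ) (a : ℤ →ᵇ ℂ) :
    circMul (fourier k) * diag circBasis a - diag circBasis a * circMul (fourier k) =
      circMul (fourier k) * diag circBasis (a - shiftSeq k a) := by
  refine clm_ext_basis circBasis fun j => ?_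
  rw [sub_apply, mul_apply_eq_comp, mul_apply_eq_comp,
    mul_apply_eq_comp, diag_basis, diag_basis, map_smul, map_smul,
    circMul_fourier_basis, diag_basis, ← sub_smul]
  rfl

theorem tendsto_jap_cocompact (C : ℝ) (x : ℝ) :
    Tendsto (fun τ => C * (jap τ x)⁻¹) (cocompact ℝ) (𝓝 0) := by
  have h : Tendsto (fun τ => jap τ x) (cocompact ℝ) atTop :=
    tendsto_atTop_mono (fun τ => abs_fst_le_jap τ x) (tendsto_norm_cocompact_atTop (E := ℝ))
  simpa using h.inv_tendsto_atTop.const_mul C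

theorem jap_le_jap_zero (τ x : ℝ) : jap τ 0 ≤ jap τ x :=
  Real.sqrt_le_sqrt (by nlinarith [sq_nonneg x])

theorem tendsto_cofinite_jap (C τ : ℝ) (k : ℤ) :
    Tendsto (fun j : ℤ => C * (jap τ ((j + k : ℤ) : ℝ))⁻¹) cofinite (𝓝 0) := by
  have h : Tendsto (fun j : ℤ => jap τ ((j + k : ℤ) : ℝ)) cofinite atTop := by
    refine tendsto_atTop_mono (fun j => abs_snd_le_jap τ _) ?_
    have h1 : Tendsto (fun j : ℤ => j + k) cofinite cofinite :=
      (add_left_injective k).tendsto_cofinite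
    have h2 : Tendsto (fun j : ℤ => |(j : ℝ)|) cofinite atTop := (tendsto_norm_cocompact_atTop (E := ℝ)).comp Int.tendsto_coe_cofinite
    exact h2.comp h1
  simpa using h.inv_tendsto_atTop.const_mul C

/-- The decay of the differences of neighbouring entries that makes commutators compact. -/
theorem commutator_fourier_mem {h : ℝ →ᵇ (ℤ →ᵇ ℂ)} (k : ℤ) (C : ℝ)
    (hC : ∀ τ j, ‖h τ j - h τ (j + k)‖ ≤ C * (jap τ ((j + k : ℤ) : ℝ))⁻¹) :
    BoundedContinuousFunction.const ℝ (circMul (fourier k)) * diagSymb h -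
      diagSymb h * BoundedContinuousFunction.const ℝ (circMul (fourier k)) ∈ compactSymb := by
  have hC0 : 0 ≤ C := by
    have := (norm_nonneg _).trans (hC 0 0)
    exact nonneg_of_mul_nonneg_left this (inv_pos.2 (jap_pos _ _))
  have e (τ : ℝ) : (BoundedContinuousFunction.const ℝ (circMul (fourier k)) * diagSymb h -
      diagSymb h * BoundedContinuousFunction.const ℝ (circMul (fourier k))) τ =
      circMul (fourier k) * diag circBasis (h τ - shiftSeq k (h τ)) :=
    commutator_fourier_diag k (h τ)
  constructor
  -- For fixed `τ` the differences tend to zero in `j`, so the diagonal factor is compact.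
  · intro τ
    rw [e]
    refine (isCompactOperator_diag circBasis _ ?_).clm_comp (circMul (fourier k))
    exact squeeze_zero_norm (fun j => hC τ j) (tendsto_cofinite_jap C τ k)
  -- For decay in `τ` the bound must be uniform in `j`; it is obtained by replacing the second
  -- argument of `jap` by `0`, where `jap` is smallest.
  · refine squeeze_zero_norm (a := fun τ => ‖circMul (fourier k)‖ * (C * (jap τ 0)⁻¹))
      (fun τ => ?_) (by simpa using (tendsto_jap_cocompact C 0).const_mul ‖circMul (fourier k)‖)
    rw [e]
    refine (norm_mul_le _ _).trans ?_
    gcongr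
    refine (norm_diag_le _ _).trans ?_
    have := (inv_pos.2 (jap_pos τ 0)).le
    refine (BoundedContinuousFunction.norm_le (by positivity)).2 fun j => (hC τ j).trans ?_
    gcongr
    · exact jap_pos _ _
    · exact jap_le_jap_zero τ _

theorem lam_shift_le (k : ℤ) (τ : ℝ) (j : ℤ) :
    |(jap τ j)⁻¹ - (jap τ ((j + k : ℤ) : ℝ))⁻¹| ≤
      |(k : ℝ)| * ((jap τ j)⁻¹ * (jap τ ((j + k : ℤ) : ℝ))⁻¹) := by
  have h := abs_inv_jap_sub_le τ τ j ((j + k : ℤ) : ℝ)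
  have e : (j : ℝ) - ((j + k : ℤ) : ℝ) = -k := by push_cast; ring
  rwa [sub_self, abs_zero, zero_add, e, abs_neg] at h

theorem norm_lam_sub_shift_le (k : ℤ) (τ : ℝ) (j : ℤ) :
    ‖lam τ j - lam τ (j + k)‖ ≤ |(k : ℝ)| * (jap τ ((j + k : ℤ) : ℝ))⁻¹ := by
  rw [lam_apply, lam_apply, ← ofReal_sub, norm_real, Real.norm_eq_abs]
  refine (lam_shift_le k τ j).trans ?_
  have h3 := (inv_pos.2 (jap_pos τ ((j + k : ℤ) : ℝ))).le
  gcongr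
  exact mul_le_of_le_one_left h3 (inv_jap_le_one _ _)

theorem norm_tlam_sub_shift_le (k : ℤ) (τ : ℝ) (j : ℤ) :
    ‖tlam τ j - tlam τ (j + k)‖ ≤ |(k : ℝ)| * (jap τ ((j + k : ℤ) : ℝ))⁻¹ := by
  have e : tlam τ j - tlam τ (j + k) =
      ((-τ * ((jap τ j)⁻¹ - (jap τ ((j + k : ℤ) : ℝ))⁻¹) : ℝ) : ℂ) := by
    rw [tlam_apply, tlam_apply, lam_apply, lam_apply]; push_cast; ring
  rw [e, norm_real, Real.norm_eq_abs, abs_mul, abs_neg]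
  have h3 := (inv_pos.2 (jap_pos τ ((j + k : ℤ) : ℝ))).le
  calc _ ≤ |τ| * (|(k : ℝ)| * ((jap τ j)⁻¹ * (jap τ ((j + k : ℤ) : ℝ))⁻¹)) := by
        gcongr; exact lam_shift_le k τ j
    _ = |(k : ℝ)| * ((|τ| * (jap τ j)⁻¹) * (jap τ ((j + k : ℤ) : ℝ))⁻¹) := by ring
    _ ≤ _ := by
        gcongr
        exact mul_le_of_le_one_left h3 (abs_fst_mul_inv_jap_le _ _)

/-- The entry `j` changes along with `λ`: of the two terms in `e`, each is at most `|k|` times the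
shifted `λ`, hence the factor `2`. -/
theorem norm_xlam_sub_shift_le (k : ℤ) (τ : ℝ) (j : ℤ) :
    ‖xlam τ j - xlam τ (j + k)‖ ≤ (2 * |(k : ℝ)|) * (jap τ ((j + k : ℤ) : ℝ))⁻¹ := by
  have e : xlam τ j - xlam τ (j + k) =
      ((j * ((jap τ j)⁻¹ - (jap τ ((j + k : ℤ) : ℝ))⁻¹) - k * (jap τ ((j + k : ℤ) : ℝ))⁻¹ : ℝ) : ℂ) := by
    rw [xlam_apply, xlam_apply, lam_apply, lam_apply]; push_cast; ring
  have h3 := (inv_pos.2 (jap_pos τ ((j + k : ℤ) : ℝ))).le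
  rw [e, norm_real, Real.norm_eq_abs]
  refine (abs_sub _ _).trans ?_
  rw [abs_mul, abs_mul, abs_of_nonneg h3]
  have : |(j : ℝ)| * |(jap τ j)⁻¹ - (jap τ ((j + k : ℤ) : ℝ))⁻¹| ≤
      |(k : ℝ)| * (jap τ ((j + k : ℤ) : ℝ))⁻¹ := by
    calc _ ≤ |(j : ℝ)| * (|(k : ℝ)| * ((jap τ j)⁻¹ * (jap τ ((j + k : ℤ) : ℝ))⁻¹)) := by
          gcongr; exact lam_shift_le k τ j
      _ = |(k : ℝ)| * ((|(j : ℝ)| * (jap τ j)⁻¹) * (jap τ ((j + k : ℤ) : ℝ))⁻¹) := by ring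
      _ ≤ _ := by
          gcongr
          exact mul_le_of_le_one_left h3 (abs_snd_mul_inv_jap_le _ _)
  linarith

/-- `a ↦ a(M_x)`, as an operator-valued function that does not depend on the parameter. -/
def constCircMul : C(Circ, ℂ) →L[ℂ] Symb :=
  LinearMap.mkContinuous
    { toFun := fun a => BoundedContinuousFunction.const ℝ (circMul a)
      map_add' := fun a b => by ext1 t; exact circMul_add a b
      map_smul' := fun c a => by ext1 t; exact circMul_smul c a } 1 fun a => by
    rw [one_mul]
    exact (BoundedContinuousFunction.norm_le (norm_nonneg _)).2 fun t => norm_circMul_le a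

theorem dense_span_fourier :
    Dense (Submodule.span ℂ (Set.range (@fourier (2 * Real.pi))) : Set C(Circ, ℂ)) := by
  intro a
  rw [← Submodule.topologicalClosure_coe, span_fourier_closure_eq_top]
  trivial

/-- Trigonometric polynomials are dense in the continuous functions and the target ideal is closed,
so single exponentials suffice. -/
theorem commutator_circMul_mem {h : ℝ →ᵇ (ℤ →ᵇ ℂ)}
    (hh : ∀ k, BoundedContinuousFunction.const ℝ (circMul (fourier k)) * diagSymb h -
      diagSymb h * BoundedContinuousFunction.const ℝ (circMul (fourier k)) ∈ compactSymb)
    (a : C(Circ, ℂ)) :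
    BoundedContinuousFunction.const ℝ (circMul a) * diagSymb h -
      diagSymb h * BoundedContinuousFunction.const ℝ (circMul a) ∈ compactSymb := by
  refine mem_compactIdeal.1 (commutator_mem_of_span_dense isClosed_compactIdeal constCircMul
    dense_span_fourier ?_ a)
  rintro _ ⟨k, rfl⟩
  exact mem_compactIdeal.2 (hh k)

/-- Only mixed pairs matter: multiplication operators commute with each other, and so do diagonal
symbols. -/
theorem commutator_generators {x y : Symb} (hx : x ∈ symbGenerators) (hy : y ∈ symbGenerators) :
    x * y - y * x ∈ compactSymb := by
  have h1 (a : C(Circ, ℂ)) {d : Symb} (hd : d ∈ ({diagSymb lam, diagSymb tlam, diagSymb xlam} : Set Symb)) :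
      BoundedContinuousFunction.const ℝ (circMul a) * d -
        d * BoundedContinuousFunction.const ℝ (circMul a) ∈ compactSymb := by
    rcases hd with rfl | rfl | rfl
    · exact commutator_circMul_mem (fun k =>
        commutator_fourier_mem k _ fun τ j => norm_lam_sub_shift_le k τ j) a
    · exact commutator_circMul_mem (fun k =>
        commutator_fourier_mem k _ fun τ j => norm_tlam_sub_shift_le k τ j) a
    · exact commutator_circMul_mem (fun k =>
        commutator_fourier_mem k _ fun τ j => norm_xlam_sub_shift_le k τ j) a
  have h2 {d : Symb} (hd : d ∈ ({diagSymb lam, diagSymb tlam, diagSymb xlam} : Set Symb)) :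
      ∃ h, d = diagSymb h := by
    rcases hd with rfl | rfl | rfl <;> exact ⟨_, rfl⟩
  rcases hx with ⟨a, -, rfl⟩ | hx <;> rcases hy with ⟨b, -, rfl⟩ | hy
  · have : BoundedContinuousFunction.const ℝ (circMul a) * BoundedContinuousFunction.const ℝ (circMul b)
        - BoundedContinuousFunction.const ℝ (circMul b) * BoundedContinuousFunction.const ℝ (circMul a)
        = 0 := by
      ext1 t
      change circMul a * circMul b - circMul b * circMul a = 0
      rw [← circMul_mul, ← circMul_mul, mul_comm a b, sub_self]
    rw [this]
    exact zero_mem_compactSymb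
  · exact h1 a hy
  · exact mem_compactIdeal.1 (commutator_swap_mem (mem_compactIdeal.2 (h1 b hx)))
  · obtain ⟨h, rfl⟩ := h2 hx
    obtain ⟨h', rfl⟩ := h2 hy
    have : diagSymb h * diagSymb h' - diagSymb h' * diagSymb h = 0 := by
      rw [← diagSymb_mul, ← diagSymb_mul, mul_comm h h']
      exact sub_self (diagSymb (h' * h))
    rw [this]
    exact zero_mem_compactSymb

theorem commutator_mem_compactSymb {f g : Symb} (hf : f ∈ Bsymb) (hg : g ∈ Bsymb) :
    f * g - g * f ∈ compactSymb :=
  mem_compactIdeal.1 (commutator_mem_of_generators isClosed_compactIdeal star_symbGenerators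
    (fun _ hx _ hy => mem_compactIdeal.2 (commutator_generators hx hy)) hf hg)

end Commutators

/-! ### Approximation of compact-operator-valued functions by matrix units -/

section Approximation

/-- A bounded family of operators that tends to zero pointwise on a compact set tends to zero
uniformly on it. -/
theorem eventually_norm_lt_of_isCompact {κ E F : Type*} {l : Filter κ} [NormedAddCommGroup E]
    [NormedSpace ℂ E] [NormedAddCommGroup F] [NormedSpace ℂ F] {K : Set E} (hK : IsCompact K)
    (L : κ → E →L[ℂ] F) {C : ℝ} (hC : ∀ i, ‖L i‖ ≤ C)
    (hL : ∀ x ∈ K, Tendsto (fun i => L i x) l (𝓝 0)) {ε : ℝ} (hε : 0 < ε) :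
    ∀ᶠ i in l, ∀ x ∈ K, ‖L i x‖ < ε := by
  -- The `+ 1` keeps the covering radius meaningful when `C = 0`.
  have hC' : 0 < |C| + 1 := by positivity
  obtain ⟨t, htK, htf, htc⟩ := hK.finite_cover_balls (e := ε / (2 * (|C| + 1))) (by positivity)
  have h1 : ∀ᶠ i in l, ∀ y ∈ t, ‖L i y‖ < ε / 2 :=
    (htf.eventually_all).2 fun y hy => by
      have := (hL y (htK hy)).norm
      rw [norm_zero] at this
      exact this.eventually (gt_mem_nhds (by positivity))
  filter_upwards [h1] with i hi x hx
  obtain ⟨y, hy, hxy⟩ := Set.mem_iUnion₂.1 (htc hx)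
  rw [Metric.mem_ball, dist_eq_norm] at hxy
  have h2 : ‖L i (x - y)‖ ≤ ε / 2 := by
    calc ‖L i (x - y)‖ ≤ ‖L i‖ * ‖x - y‖ := (L i).le_opNorm _
      _ ≤ (|C| + 1) * (ε / (2 * (|C| + 1))) := by
        gcongr
        exact (hC i).trans ((le_abs_self C).trans (by linarith))
      _ = ε / 2 := by field_simp
  calc ‖L i x‖ = ‖L i (x - y) + L i y‖ := by rw [← map_add, sub_add_cancel]
    _ ≤ ‖L i (x - y)‖ + ‖L i y‖ := norm_add_le _ _
    _ < ε := by linarith [hi y hy]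

variable {ι H : Type*} [NormedAddCommGroup H] [InnerProductSpace ℂ H]

theorem matrixUnit_mul_mul (b : HilbertBasis ι ℂ H) (i j : ι) (T : H →L[ℂ] H) :
    matrixUnit b i i * T * matrixUnit b j j = b.repr (T (b j)) i • matrixUnit b i j := by
  ext v
  simp only [mul_apply_eq_comp, matrixUnit_apply, map_smul, smul_apply, smul_smul]
  rw [mul_comm]

theorem star_matrixUnit [CompleteSpace H] (b : HilbertBasis ι ℂ H) (i : ι) :
    star (matrixUnit b i i) = matrixUnit b i i := by
  rw [ContinuousLinearMap.star_eq_adjoint]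
  refine ((ContinuousLinearMap.eq_adjoint_iff _ _).2 fun u v => ?_).symm
  rw [matrixUnit_apply, matrixUnit_apply, inner_smul_left, inner_smul_right, b.repr_apply_apply,
    b.repr_apply_apply, inner_conj_symm, mul_comm]

variable [TopologicalSpace ι] [DiscreteTopology ι]

open scoped Classical in
/-- The indicator function of the complement of a finite set. -/
def complIndicator (s : Finset ι) : ι →ᵇ ℂ :=
  BoundedContinuousFunction.ofNormedAddCommGroup (fun i => if i ∈ s then 0 else 1)
    continuous_of_discreteTopology 1 fun i => by split_ifs <;> simp

theorem norm_complIndicator_le (s : Finset ι) : ‖complIndicator s‖ ≤ 1 :=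
  BoundedContinuousFunction.norm_ofNormedAddCommGroup_le _ zero_le_one _

variable [CompleteSpace H]

theorem diag_complIndicator (b : HilbertBasis ι ℂ H) (s : Finset ι) :
    diag b (complIndicator s) = 1 - ∑ i ∈ s, matrixUnit b i i := by
  classical
  refine clm_ext_basis b fun j => ?_
  have : complIndicator s j = if j ∈ s then 0 else 1 := by
    simp only [complIndicator, BoundedContinuousFunction.coe_ofNormedAddCommGroup]
  rw [diag_basis, this, sub_apply, sum_apply]
  simp only [matrixUnit_apply, repr_basis, ite_smul, one_smul, zero_smul, Finset.sum_ite_eq']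
  split_ifs <;> simp

theorem tendsto_diag_complIndicator (b : HilbertBasis ι ℂ H) (v : H) :
    Tendsto (fun s => diag b (complIndicator s) v) atTop (𝓝 0) := by
  have h : Tendsto (fun s : Finset ι => ∑ i ∈ s, b.repr v i • b i) atTop (𝓝 v) := b.hasSum_repr v
  have := (tendsto_const_nhds (x := v)).sub h
  rw [sub_self] at this
  refine this.congr fun s => ?_
  rw [diag_complIndicator, sub_apply, sum_apply]
  simp only [matrixUnit_apply, one_apply_eq_self]

theorem norm_diag_complIndicator_le (b : HilbertBasis ι ℂ H) (s : Finset ι) :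
    ‖diag b (complIndicator s)‖ ≤ 1 :=
  (norm_diag_le b _).trans (norm_complIndicator_le s)

/-- Strong convergence of the tail projections is uniform on the compact closure of the image of the
unit ball under `T`, which is norm convergence of the products. -/
theorem tendsto_diag_complIndicator_mul (b : HilbertBasis ι ℂ H) {T : H →L[ℂ] H}
    (hT : IsCompactOperator T) :
    Tendsto (fun s => diag b (complIndicator s) * T) atTop (𝓝 0) := by
  rw [Metric.tendsto_nhds]
  intro ε hε
  filter_upwards [eventually_norm_lt_of_isCompact (hT.isCompact_closure_image_closedBall 1)
    (fun s => diag b (complIndicator s)) (norm_diag_complIndicator_le b)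
    (fun x _ => tendsto_diag_complIndicator b x) (half_pos hε)] with s hs
  rw [dist_zero_right]
  refine (ContinuousLinearMap.opNorm_le_of_unit_norm (by positivity) fun v hv => ?_).trans_lt
    (half_lt_self hε)
  exact (hs (T v) (subset_closure ⟨v, by simp [hv], rfl⟩)).le

variable {X : Type*} [TopologicalSpace X]

/-- A `C₀` function with values in the compact operators is the sum of its rows. -/
theorem hasSum_matrixUnit_mul (b : HilbertBasis ι ℂ H) {f : X →ᵇ (H →L[ℂ] H)}
    (hf : ∀ t, IsCompactOperator (f t)) (hf0 : Tendsto f (cocompact X) (𝓝 0)) :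
    HasSum (fun i => BoundedContinuousFunction.const X (matrixUnit b i i) * f) f := by
  rw [HasSum, Metric.tendsto_nhds]
  intro ε hε
  -- The compactness principle is used a second time, now in the space of operators: a `C₀` function
  -- has relatively compact range, so the tails are small uniformly in `t`.
  have hK : IsCompact (insert 0 (Set.range f)) :=
    hf0.isCompact_insert_range_of_cocompact f.continuous
  have hm (T : H →L[ℂ] H) (hT : T ∈ insert 0 (Set.range f)) : IsCompactOperator T := by
    rcases hT with rfl | ⟨t, rfl⟩
    · exact isCompactOperator_zero
    · exact hf t
  filter_upwards [eventually_norm_lt_of_isCompact hK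
    (fun s => ContinuousLinearMap.mul ℂ (H →L[ℂ] H) (diag b (complIndicator s)))
    (fun s => (ContinuousLinearMap.opNorm_mul_apply_le _ _ _).trans
      (norm_diag_complIndicator_le b s))
    (fun T hT => tendsto_diag_complIndicator_mul b (hm T hT)) (half_pos hε)] with s hs
  rw [dist_comm, dist_eq_norm]
  refine lt_of_le_of_lt ((BoundedContinuousFunction.norm_le (half_pos hε).le).2 fun t => ?_)
    (half_lt_self hε)
  have e : (f - ∑ i ∈ s, BoundedContinuousFunction.const X (matrixUnit b i i) * f) t =
      diag b (complIndicator s) * f t := by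
    rw [diag_complIndicator, sub_mul, one_mul, Finset.sum_mul, BoundedContinuousFunction.sub_apply,
      BoundedContinuousFunction.sum_apply]
    rfl
  rw [e]
  exact (hs (f t) (Set.mem_insert_of_mem _ ⟨t, rfl⟩)).le

/-- A closed additive set of operator-valued functions that contains all multiples of matrix units
contains `C₀(X, K(H))`. -/
theorem mem_of_matrixUnit_mem (b : HilbertBasis ι ℂ H) {I : Set (X →ᵇ (H →L[ℂ] H))}
    (hI : IsClosed I) (zero_mem : 0 ∈ I) (add_mem : ∀ {x y}, x ∈ I → y ∈ I → x + y ∈ I)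
    (h : ∀ (ψ : C₀(X, ℂ)) (i j : ι) (g : X →ᵇ (H →L[ℂ] H)),
      (∀ t, g t = ψ t • matrixUnit b i j) → g ∈ I)
    {f : X →ᵇ (H →L[ℂ] H)} (hf : ∀ t, IsCompactOperator (f t))
    (hf0 : Tendsto f (cocompact X) (𝓝 0)) : f ∈ I := by
  let M : AddSubmonoid (X →ᵇ (H →L[ℂ] H)) := ⟨⟨I, add_mem⟩, zero_mem⟩
  refine hI.mem_of_tendsto (hasSum_matrixUnit_mul b hf hf0) (Eventually.of_forall fun s => ?_)
  refine M.sum_mem (t := s) fun i _ => ?_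
  let g := BoundedContinuousFunction.const X (matrixUnit b i i) * f
  -- The columns are obtained from the rows of `star g` by taking adjoints.
  have hg : HasSum (fun j => g * BoundedContinuousFunction.const X (matrixUnit b j j)) g := by
    have e (t : X) : star g t = star (f t) * matrixUnit b i i := by
      change star (matrixUnit b i i * f t) = _
      rw [star_mul, star_matrixUnit]
    have hc (t : X) : IsCompactOperator (star g t) := by
      rw [e]
      exact (isCompactOperator_matrixUnit b i i).clm_comp (star (f t))
    have h0 : Tendsto (star g) (cocompact X) (𝓝 0) := by
      have h1 := hf0.star.mul_const (matrixUnit b i i)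
      rw [star_zero, zero_mul] at h1
      exact h1.congr fun t => (e t).symm
    have h2 := (hasSum_matrixUnit_mul b hc h0).star
    rw [star_star] at h2
    convert h2 using 2 with j
    ext1 t
    change g t * matrixUnit b j j = star (matrixUnit b j j * star (g t))
    rw [star_mul, star_star, star_matrixUnit]
  refine hI.mem_of_tendsto hg (Eventually.of_forall fun s => ?_)
  refine M.sum_mem (t := s) fun j _ => ?_
  have hcont : Continuous fun t => b.repr (f t (b j)) i := by
    simp only [b.repr_apply_apply]
    fun_prop
  have hzero : Tendsto (fun t => b.repr (f t (b j)) i) (cocompact X) (𝓝 0) := by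
    simp only [b.repr_apply_apply]
    have h1 : Continuous fun T : H →L[ℂ] H => inner ℂ (b i) (T (b j)) := by fun_prop
    have h2 := (h1.tendsto 0).comp hf0
    rwa [zero_apply, inner_zero_right] at h2
  exact h ⟨⟨_, hcont⟩, hzero⟩ i j _ fun t => matrixUnit_mul_mul b i j (f t)

end Approximation

/-! ### Diagonal symbols that vanish at infinity -/

section DiagonalSymbols

/-- A `C₀` function on `ℝ × ℤ` as a function on `ℝ` with values in the sequences. -/
def toSeq (G : C₀(ℝ × ℤ, ℂ)) : ℝ →ᵇ (ℤ →ᵇ ℂ) :=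
  BoundedContinuousFunction.ofNormedAddCommGroup
    (fun τ => BoundedContinuousFunction.ofNormedAddCommGroup (fun j : ℤ => G (τ, j))
      continuous_of_discreteTopology ‖G.toBCF‖ fun j => G.toBCF.norm_coe_le_norm (τ, j))
    (by
      rw [Metric.continuous_iff]
      intro τ ε hε
      -- Uniform continuity of `G` on `ℝ × ℤ` provides a `δ` valid for all `j`, as the sup norm over
      -- `j` demands.
      obtain ⟨δ, hδ, h⟩ := Metric.uniformContinuous_iff.1
        (ZeroAtInftyContinuousMap.uniformContinuous G) (ε / 2) (half_pos hε)
      refine ⟨δ, hδ, fun σ hσ => lt_of_le_of_lt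
        ((BoundedContinuousFunction.dist_le (half_pos hε).le).2 fun j => (h ?_).le)
        (half_lt_self hε)⟩
      rwa [Prod.dist_eq, dist_self, max_eq_left dist_nonneg])
    ‖G.toBCF‖ fun τ => BoundedContinuousFunction.norm_ofNormedAddCommGroup_le _ (norm_nonneg _) _

theorem toSeq_apply (G : C₀(ℝ × ℤ, ℂ)) (τ : ℝ) (j : ℤ) : toSeq G τ j = G (τ, j) := rfl

/-- A continuous function on the one-point compactification of `ℝ × ℤ`, normalised to vanish at
infinity. -/
def restr (F : C(OnePoint (ℝ × ℤ), ℂ)) : C₀(ℝ × ℤ, ℂ) where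
  toFun p := F p - F OnePoint.infty
  continuous_toFun := by
    have : Continuous fun p : ℝ × ℤ => F p := F.continuous.comp OnePoint.continuous_coe
    exact this.sub continuous_const
  zero_at_infty' := by
    have h := OnePoint.continuousAt_infty'.1 (F.continuous.continuousAt (x := OnePoint.infty))
    rw [coclosedCompact_eq_cocompact] at h
    have h' := h.sub_const (F OnePoint.infty)
    rwa [sub_self] at h'

theorem restr_apply (F : C(OnePoint (ℝ × ℤ), ℂ)) (p : ℝ × ℤ) :
    restr F p = F p - F OnePoint.infty := rfl

/-- The extension of a `C₀` function to the one-point compactification. -/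
def extend (G : C₀(ℝ × ℤ, ℂ)) : C(OnePoint (ℝ × ℤ), ℂ) :=
  OnePoint.continuousMapMk G.toContinuousMap 0 (by
    rw [coclosedCompact_eq_cocompact]; exact zero_at_infty G)

theorem extend_coe (G : C₀(ℝ × ℤ, ℂ)) (p : ℝ × ℤ) : extend G p = G p := rfl

theorem extend_infty (G : C₀(ℝ × ℤ, ℂ)) : extend G OnePoint.infty = 0 := rfl

theorem restr_extend (G : C₀(ℝ × ℤ, ℂ)) : restr (extend G) = G := by
  ext p
  rw [restr_apply, extend_coe, extend_infty, sub_zero]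

/-- The diagonal symbol of a function on the one-point compactification of `ℝ × ℤ`. -/
def symbOf : C(OnePoint (ℝ × ℤ), ℂ) →L[ℂ] Symb :=
  LinearMap.mkContinuous
    { toFun := fun F => diagSymb (toSeq (restr F))
      map_add' := fun F G => by
        rw [← diagSymb_add]
        congr 1
        ext τ j
        simp only [toSeq_apply, restr_apply, ContinuousMap.add_apply,
          BoundedContinuousFunction.add_apply]
        ring
      map_smul' := fun c F => by
        rw [RingHom.id_apply, ← diagSymb_smul]
        congr 1
        ext τ j
        simp only [toSeq_apply, restr_apply, ContinuousMap.smul_apply,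
          BoundedContinuousFunction.smul_apply, smul_eq_mul]
        ring } 2 fun F => by
    refine (norm_diagSymb_le _).trans ?_
    refine (BoundedContinuousFunction.norm_le (by positivity)).2 fun τ => ?_
    refine (BoundedContinuousFunction.norm_le (by positivity)).2 fun j => ?_
    rw [toSeq_apply, restr_apply]
    calc _ ≤ ‖F (τ, j)‖ + ‖F OnePoint.infty‖ := norm_sub_le _ _
      _ ≤ ‖F‖ + ‖F‖ := add_le_add (F.norm_coe_le_norm _) (F.norm_coe_le_norm _)
      _ = 2 * ‖F‖ := by ring

theorem symbOf_apply (F : C(OnePoint (ℝ × ℤ), ℂ)) : symbOf F = diagSymb (toSeq (restr F)) := rfl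

/-- Subtracting the value at infinity destroys multiplicativity; the extra terms are multiples of
`symbOf F` and `symbOf G`, so products of preimages of an ideal remain in it. -/
theorem symbOf_mul (F G : C(OnePoint (ℝ × ℤ), ℂ)) :
    symbOf (F * G) = symbOf F * symbOf G + F OnePoint.infty • symbOf G +
      G OnePoint.infty • symbOf F := by
  simp only [symbOf_apply, ← diagSymb_add, ← diagSymb_smul, ← diagSymb_mul]
  congr 1
  ext τ j
  simp only [toSeq_apply, restr_apply, ContinuousMap.mul_apply, BoundedContinuousFunction.mul_apply,
    BoundedContinuousFunction.add_apply, BoundedContinuousFunction.smul_apply, smul_eq_mul]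
  ring

theorem symbOf_star (F : C(OnePoint (ℝ × ℤ), ℂ)) : symbOf (star F) = star (symbOf F) := by
  rw [symbOf_apply, symbOf_apply, ← diagSymb_star]
  congr 1
  ext τ j
  simp only [toSeq_apply, restr_apply, ContinuousMap.star_apply,
    BoundedContinuousFunction.star_apply, star_sub]

/-- Since constants are sent to zero, the preimage of an ideal is a unital subalgebra, as
Stone–Weierstrass on the compactification requires. -/
theorem symbOf_algebraMap (c : ℂ) : symbOf (algebraMap ℂ _ c) = 0 := by
  have h : toSeq (restr (algebraMap ℂ _ c)) = (0 : ℂ) • 0 := by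
    ext τ j
    simp [toSeq_apply, restr_apply]
  rw [symbOf_apply, h, diagSymb_smul]
  exact zero_smul ℂ (diagSymb 0)

/-- The closed ideals of the algebra of symbols that contain all commutators. -/
structure IsCommutatorIdeal (I : Set Symb) : Prop where
  isClosed : IsClosed I
  subset : I ⊆ Bsymb
  zero_mem : 0 ∈ I
  add_mem {x y : Symb} : x ∈ I → y ∈ I → x + y ∈ I
  mul_mem_left {x y : Symb} : x ∈ Bsymb → y ∈ I → x * y ∈ I
  mul_mem_right {x y : Symb} : x ∈ I → y ∈ Bsymb → x * y ∈ I
  commutator_mem {x y : Symb} : x ∈ Bsymb → y ∈ Bsymb → x * y - y * x ∈ I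

variable {I : Set Symb}

theorem IsCommutatorIdeal.smul_mem (hI : IsCommutatorIdeal I) (c : ℂ) {x : Symb} (hx : x ∈ I) :
    c • x ∈ I := by
  have h := hI.mul_mem_left (Bsymb.algebraMap_mem c) hx
  rwa [← Algebra.smul_def] at h

/-- The functions whose diagonal symbols belong to an ideal. -/
def diagPreimage (hI : IsCommutatorIdeal I) : StarSubalgebra ℂ C(OnePoint (ℝ × ℤ), ℂ) where
  -- Both conditions are imposed because `I` is not assumed to be closed under `star`.
  carrier := {F | symbOf F ∈ I ∧ symbOf (star F) ∈ I}
  mul_mem' {F G} hF hG := by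
    have h {F G} (hF : symbOf F ∈ I) (hG : symbOf G ∈ I) : symbOf (F * G) ∈ I := by
      rw [symbOf_mul]
      exact hI.add_mem (hI.add_mem (hI.mul_mem_left (hI.subset hF) hG) (hI.smul_mem _ hG))
        (hI.smul_mem _ hF)
    refine ⟨h hF.1 hG.1, ?_⟩
    rw [star_mul]
    exact h hG.2 hF.2
  add_mem' {F G} hF hG := by
    refine ⟨?_, ?_⟩
    · rw [map_add]; exact hI.add_mem hF.1 hG.1
    · rw [star_add, map_add]; exact hI.add_mem hF.2 hG.2
  algebraMap_mem' c := by
    refine ⟨?_, ?_⟩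
    · rw [symbOf_algebraMap]; exact hI.zero_mem
    · rw [← algebraMap_star_comm, symbOf_algebraMap]; exact hI.zero_mem
  star_mem' {F} hF := ⟨hF.2, by rw [star_star]; exact hF.1⟩

theorem isClosed_diagPreimage (hI : IsCommutatorIdeal I) :
    IsClosed (diagPreimage hI : Set C(OnePoint (ℝ × ℤ), ℂ)) :=
  (hI.isClosed.preimage symbOf.continuous).inter
    (hI.isClosed.preimage (symbOf.continuous.comp continuous_star))

/-- The difference of the neighbouring entries of the symbol of `Λ`, times a bounded factor. -/
def lamDiff (h : ℝ →ᵇ (ℤ →ᵇ ℂ)) : C₀(ℝ × ℤ, ℂ) where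
  toFun p := (lam p.1 p.2 - lam p.1 (p.2 + 1)) * h p.1 p.2
  continuous_toFun := by
    have hc (g : ℝ →ᵇ (ℤ →ᵇ ℂ)) (k : ℤ) : Continuous fun p : ℝ × ℤ => g p.1 (p.2 + k) :=
      continuous_eval.comp ((g.continuous.comp continuous_fst).prodMk
        ((continuous_of_discreteTopology (f := fun j : ℤ => j + k)).comp continuous_snd))
    have h0 := hc lam 0
    have h1 := hc h 0
    simp only [add_zero] at h0 h1
    exact (h0.sub (hc lam 1)).mul h1
  zero_at_infty' := by
    have h1 : Tendsto (fun p : ℝ × ℤ => jap p.1 p.2) (cocompact (ℝ × ℤ)) atTop := by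
      refine tendsto_atTop_mono (fun p => ?_) (tendsto_norm_cocompact_atTop (E := ℝ × ℤ))
      exact max_le (abs_fst_le_jap p.1 p.2) ((Int.norm_eq_abs p.2).trans_le (abs_snd_le_jap p.1 p.2))
    have h2 := h1.inv_tendsto_atTop.mul_const ‖h‖
    rw [zero_mul] at h2
    refine squeeze_zero_norm (fun p => ?_) h2
    rw [norm_mul, Pi.inv_apply]
    have h3 : ‖lam p.1 p.2 - lam p.1 (p.2 + 1)‖ ≤ (jap p.1 p.2)⁻¹ := by
      rw [lam_apply, lam_apply, ← ofReal_sub, norm_real, Real.norm_eq_abs]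
      refine (lam_shift_le 1 p.1 p.2).trans ?_
      rw [Int.cast_one, abs_one, one_mul]
      exact mul_le_of_le_one_right (inv_pos.2 (jap_pos _ _)).le (inv_jap_le_one _ _)
    gcongr
    · exact (inv_pos.2 (jap_pos _ _)).le
    · exact ((h p.1).norm_coe_le_norm p.2).trans (h.norm_coe_le_norm p.1)

theorem lamDiff_apply (h : ℝ →ᵇ (ℤ →ᵇ ℂ)) (p : ℝ × ℤ) :
    lamDiff h p = (lam p.1 p.2 - lam p.1 (p.2 + 1)) * h p.1 p.2 := rfl

theorem smoothOnCirc_fourier (k : ℤ) : SmoothOnCirc (fourier k : C(Circ, ℂ)) := by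
  have : (fun x : ℝ => (fourier k : C(Circ, ℂ)) (x : Circ)) =
      fun x : ℝ => Complex.exp (2 * Real.pi * I * k * x / (2 * Real.pi : ℝ)) := by
    ext x
    exact fourier_coe_apply
  rw [SmoothOnCirc, this]
  have h : ContDiff ℝ ∞ (fun x : ℝ => (x : ℂ)) := ofRealCLM.contDiff
  exact ((contDiff_const.mul h).div_const _).cexp

theorem const_fourier_mem (k : ℤ) :
    BoundedContinuousFunction.const ℝ (circMul (fourier k)) ∈ Bsymb :=
  symbGenerators_subset (Or.inl ⟨_, smoothOnCirc_fourier k, rfl⟩)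

theorem circMul_fourier_mul (k l : ℤ) :
    circMul (fourier k) * circMul (fourier l) = circMul (fourier (k + l)) := by
  refine clm_ext_basis circBasis fun j => ?_
  rw [mul_apply_eq_comp, circMul_fourier_basis, circMul_fourier_basis, circMul_fourier_basis]
  congr 1
  ring

theorem circMul_fourier_zero : circMul (fourier 0) = 1 := by
  refine clm_ext_basis circBasis fun j => ?_
  rw [circMul_fourier_basis, add_zero, one_apply_eq_self]

/-- The element is `e^{-ix} [e^{ix}, Λ] h` at the level of symbols: the outer exponential cancels
the shift in the commutator and leaves a diagonal operator. -/
theorem diagSymb_lamDiff_mem (hI : IsCommutatorIdeal I) {h : ℝ →ᵇ (ℤ →ᵇ ℂ)}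
    (hh : diagSymb h ∈ Bsymb) : diagSymb (toSeq (lamDiff h)) ∈ I := by
  let S (k : ℤ) : Symb := BoundedContinuousFunction.const ℝ (circMul (fourier k))
  have hlam : diagSymb lam ∈ Bsymb := symbGenerators_subset (Or.inr (Or.inl rfl))
  have e : diagSymb (toSeq (lamDiff h)) =
      S (-1) * (S 1 * diagSymb lam - diagSymb lam * S 1) * diagSymb h := by
    ext1 τ
    change diag circBasis _ = circMul (fourier (-1)) * (circMul (fourier 1) * diag circBasis (lam τ) -
      diag circBasis (lam τ) * circMul (fourier 1)) * diag circBasis (h τ)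
    rw [commutator_fourier_diag, ← mul_assoc, circMul_fourier_mul, neg_add_cancel,
      circMul_fourier_zero, one_mul, ← map_mul]
    rfl
  rw [e]
  exact hI.mul_mem_right (hI.mul_mem_left (const_fourier_mem _)
    (hI.commutator_mem (const_fourier_mem _) hlam)) hh

/-- Equality would force `j² = (j+1)²`, that is `2j = -1`, impossible for an integer. -/
theorem lam_sub_ne_zero (τ : ℝ) (j : ℤ) : lam τ j - lam τ (j + 1) ≠ 0 := by
  rw [lam_apply, lam_apply, sub_ne_zero, Ne, ofReal_inj, inv_inj]
  intro h
  have h1 := congrArg (· ^ 2) h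
  simp only [jap_sq] at h1
  have h2 : ((j : ℝ)) ^ 2 = ((j + 1 : ℤ) : ℝ) ^ 2 := by linarith
  have h3 : j ^ 2 = (j + 1) ^ 2 := by exact_mod_cast h2
  have : 2 * j = -1 := by linarith
  omega

/-- The nowhere vanishing `lamDiff 1` separates finite points from infinity. At two finite points
where all four functions agree, dividing by it yields equal `λ`, `-τλ` and `jλ`, and then equal `τ`
and `j`. -/
theorem separatesPoints_diagPreimage (hI : IsCommutatorIdeal I) :
    (diagPreimage hI).SeparatesPoints := by
  have hm {h : ℝ →ᵇ (ℤ →ᵇ ℂ)} (hh : diagSymb h ∈ Bsymb) (hs : star h = h) :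
      extend (lamDiff h) ∈ diagPreimage hI := by
    have h1 : symbOf (extend (lamDiff h)) ∈ I := by
      rw [symbOf_apply, restr_extend]
      exact diagSymb_lamDiff_mem hI hh
    refine ⟨h1, ?_⟩
    have e : star (toSeq (lamDiff h)) = toSeq (lamDiff h) := by
      ext τ j
      have h2 : star (h τ j) = h τ j := congrArg (fun g : ℝ →ᵇ (ℤ →ᵇ ℂ) => g τ j) hs
      have h3 (k : ℤ) : star (lam τ k) = lam τ k :=
        congrArg (fun g : ℝ →ᵇ (ℤ →ᵇ ℂ) => g τ k) star_lam
      simp only [BoundedContinuousFunction.star_apply, toSeq_apply, lamDiff_apply, star_mul,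
        star_sub, h2, h3]
      ring
    rw [symbOf_star, symbOf_apply, restr_extend, ← diagSymb_star, e]
    exact diagSymb_lamDiff_mem hI hh
  have hone : diagSymb 1 ∈ Bsymb := by
    have : diagSymb 1 = 1 := by
      ext1 τ
      exact map_one (diag circBasis)
    rw [this]
    exact one_mem _
  have m0 := hm hone (by ext τ j; exact star_one ℂ)
  have m1 := hm (symbGenerators_subset (Or.inr (Or.inl rfl))) star_lam
  have m2 := hm (symbGenerators_subset (Or.inr (Or.inr (Or.inl rfl)))) star_tlam
  have m3 := hm (symbGenerators_subset (Or.inr (Or.inr (Or.inr rfl)))) star_xlam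
  have key (p : ℝ × ℤ) : extend (lamDiff 1) p ≠ 0 := by
    rw [extend_coe, lamDiff_apply]
    exact mul_ne_zero (lam_sub_ne_zero _ _) one_ne_zero
  intro x y hxy
  by_contra! hcon
  have hcon' {F : C(OnePoint (ℝ × ℤ), ℂ)} (hF : F ∈ diagPreimage hI) : F x = F y :=
    hcon _ ⟨F, hF, rfl⟩
  induction x using OnePoint.rec with
  | infty =>
    induction y using OnePoint.rec with
    | infty => exact hxy rfl
    | coe q => exact key q (hcon' m0).symm
  | coe p =>
    induction y using OnePoint.rec with
    | infty => exact key p (hcon' m0)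
    | coe q =>
      have e0 := hcon' m0
      have e1 := hcon' m1
      have e2 := hcon' m2
      have e3 := hcon' m3
      simp only [extend_coe, lamDiff_apply] at e0 e1 e2 e3
      have hp := lam_sub_ne_zero p.1 p.2
      have e0' : lam p.1 p.2 - lam p.1 (p.2 + 1) = lam q.1 q.2 - lam q.1 (q.2 + 1) := by
        simpa using e0
      rw [← e0'] at e1 e2 e3
      have f1 := mul_left_cancel₀ hp e1
      have f2 := mul_left_cancel₀ hp e2
      have f3 := mul_left_cancel₀ hp e3
      have hl : lam p.1 p.2 ≠ 0 := by
        rw [lam_apply, Ne, ofReal_eq_zero]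
        exact inv_ne_zero (jap_pos _ _).ne'
      rw [tlam_apply, tlam_apply, ← f1] at f2
      rw [xlam_apply, xlam_apply, ← f1] at f3
      have g2 := neg_injective (mul_right_cancel₀ hl f2)
      have g3 := mul_right_cancel₀ hl f3
      refine hxy (congrArg _ (Prod.ext ?_ ?_))
      · exact_mod_cast g2
      · exact_mod_cast g3

/-- All diagonal symbols that vanish at infinity belong to the ideal. -/
theorem diagSymb_toSeq_mem (hI : IsCommutatorIdeal I) (G : C₀(ℝ × ℤ, ℂ)) :
    diagSymb (toSeq G) ∈ I := by
  have h : extend G ∈ (diagPreimage hI).topologicalClosure := by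
    rw [ContinuousMap.starSubalgebra_topologicalClosure_eq_top_of_separatesPoints _
      (separatesPoints_diagPreimage hI)]
    trivial
  have h' : extend G ∈ diagPreimage hI := (isClosed_diagPreimage hI).closure_subset h
  have := h'.1
  rwa [symbOf_apply, restr_extend] at this

/-- The function `ψ ⊗ δ₀` on `ℝ × ℤ`. -/
def tensorSingle (ψ : C₀(ℝ, ℂ)) : C₀(ℝ × ℤ, ℂ) where
  toFun p := ψ p.1 * if p.2 = 0 then 1 else 0
  continuous_toFun := (ψ.continuous.comp continuous_fst).mul
    ((continuous_of_discreteTopology (f := fun j : ℤ => if j = 0 then (1 : ℂ) else 0)).comp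
      continuous_snd)
  zero_at_infty' := by
    rw [Metric.tendsto_nhds]
    intro ε hε
    obtain ⟨K, hK, hKε⟩ := mem_cocompact.1 ((Metric.tendsto_nhds.1 (zero_at_infty ψ)) ε hε)
    refine mem_cocompact.2 ⟨K ×ˢ {0}, hK.prod isCompact_singleton, fun p hp => ?_⟩
    by_cases h0 : p.2 = 0
    · have h1 : p.1 ∉ K := fun h => hp ⟨h, h0⟩
      simpa [h0] using hKε h1
    · simpa [h0] using hε

/-- Shift by `-j`, project onto the zeroth mode with weight `ψ`, shift by `i`: the result sends the
`j`-th basis vector to `ψ` times the `i`-th and kills the others. -/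
theorem smul_matrixUnit_mem (hI : IsCommutatorIdeal I) (ψ : C₀(ℝ, ℂ)) (i j : ℤ) (g : Symb)
    (hg : ∀ τ, g τ = ψ τ • matrixUnit circBasis i j) : g ∈ I := by
  have e : g = BoundedContinuousFunction.const ℝ (circMul (fourier i)) *
      diagSymb (toSeq (tensorSingle ψ)) *
      BoundedContinuousFunction.const ℝ (circMul (fourier (-j))) := by
    ext1 τ
    rw [hg]
    refine clm_ext_basis circBasis fun k => ?_
    change _ = circMul (fourier i) (diag circBasis (toSeq (tensorSingle ψ) τ)
      (circMul (fourier (-j)) (circBasis k)))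
    have hs : toSeq (tensorSingle ψ) τ (k + -j) = ψ τ * if k + -j = 0 then 1 else 0 := rfl
    rw [circMul_fourier_basis, diag_basis, map_smul, circMul_fourier_basis, hs, smul_apply,
      matrixUnit_apply, repr_basis]
    rcases eq_or_ne k j with rfl | hkj
    · simp
    · have : k + -j ≠ 0 := by omega
      simp [this, hkj.symm]
  rw [e]
  exact hI.mul_mem_right (hI.mul_mem_left (const_fourier_mem _) (diagSymb_toSeq_mem hI _))
    (const_fourier_mem _)

theorem compactSymb_subset (hI : IsCommutatorIdeal I) : compactSymb ⊆ I := fun _ hf =>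
  mem_of_matrixUnit_mem circBasis hI.isClosed hI.zero_mem hI.add_mem
    (smul_matrixUnit_mem hI) hf.1 hf.2

end DiagonalSymbols

/-! ### The commutator ideal -/

section CommutatorIdeal

theorem mulOp_mem_Bdagger {f : Symb} (hf : f ∈ Bsymb) : mulOp volume f ∈ Bdagger :=
  (mem_Bdagger _).2 ⟨f, hf, rfl⟩

theorem exists_eq_mulOp (b : Bdagger) : ∃ f ∈ Bsymb, mulOp volume f = b.1 :=
  (mem_Bdagger _).1 b.2

/-- The ideal `C₀(ℝ, K)` of `ℬ†`. -/
def compactIdealBdagger : TwoSidedIdeal Bdagger :=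
  TwoSidedIdeal.mk' {b | ∃ f ∈ compactSymb, mulOp volume f = b.1}
    ⟨0, zero_mem_compactSymb, map_zero _⟩
    (by
      rintro x y ⟨f, hf, hx⟩ ⟨g, hg, hy⟩
      exact ⟨f + g, add_mem_compactSymb hf hg, (map_add _ f g).trans (congrArg₂ _ hx hy)⟩)
    (by
      rintro x ⟨f, hf, hx⟩
      exact ⟨-f, neg_mem_compactSymb hf, (map_neg _ f).trans (congrArg _ hx)⟩)
    (by
      rintro x y ⟨f, hf, hy⟩
      obtain ⟨g, -, hx⟩ := exists_eq_mulOp x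
      exact ⟨g * f, mul_mem_compactSymb_left g hf, (map_mul _ g f).trans (congrArg₂ _ hx hy)⟩)
    (by
      rintro x y ⟨f, hf, hx⟩
      obtain ⟨g, -, hy⟩ := exists_eq_mulOp y
      exact ⟨f * g, mul_mem_compactSymb_right g hf, (map_mul _ f g).trans (congrArg₂ _ hx hy)⟩)

theorem mem_compactIdealBdagger {b : Bdagger} :
    b ∈ compactIdealBdagger ↔ b.1 ∈ mulOp (E := L2Circ) (volume : Measure ℝ) '' compactSymb :=
  TwoSidedIdeal.mem_mk' _ _ _ _ _ _ _

theorem isClosed_compactIdealBdagger : IsClosed (compactIdealBdagger : Set Bdagger) := by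
  have h : (compactIdealBdagger : Set Bdagger) =
      Subtype.val ⁻¹' (mulOp (E := L2Circ) (volume : Measure ℝ) '' compactSymb) :=
    Set.ext fun _ => mem_compactIdealBdagger
  rw [h]
  exact (isometry_mulOp.isClosedEmbedding.isClosedMap _ isClosed_compactSymb).preimage
    continuous_subtype_val

theorem commutatorIdeal_le : commutatorIdeal Bdagger ≤ compactIdealBdagger := by
  refine sInf_le ⟨isClosed_compactIdealBdagger, fun a b => ?_⟩
  obtain ⟨f, hf, ha⟩ := exists_eq_mulOp a
  obtain ⟨g, hg, hb⟩ := exists_eq_mulOp b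
  refine mem_compactIdealBdagger.2 ⟨f * g - g * f, commutator_mem_compactSymb hf hg, ?_⟩
  refine (map_sub (mulOp volume) (f * g) (g * f)).trans ?_
  rw [map_mul, map_mul, ha, hb]
  rfl

/-- The symbols of the elements of an ideal of `ℬ†`. -/
def symbols (J : TwoSidedIdeal Bdagger) : Set Symb :=
  {f | ∃ b ∈ J, mulOp volume f = b.1}

/-- Transfers an ideal of operators to the symbol side; closedness survives because `mulOp` is
isometric and `ℬ†` is closed. -/
theorem isCommutatorIdeal_symbols {J : TwoSidedIdeal Bdagger} (hJ : IsClosed (J : Set Bdagger))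
    (h : ∀ a b : Bdagger, a * b - b * a ∈ J) : IsCommutatorIdeal (symbols J) where
  isClosed := by
    have e : symbols J = mulOp volume ⁻¹' (Subtype.val '' (J : Set Bdagger)) :=
      Set.ext fun f => exists_congr fun b => and_congr Iff.rfl eq_comm
    rw [e]
    have hB : IsClosed (Bdagger : Set (L2Cyl →L[ℂ] L2Cyl)) := by
      have : (Bdagger : Set (L2Cyl →L[ℂ] L2Cyl)) = mulOp volume '' (Bsymb : Set Symb) :=
        Set.ext fun T => mem_Bdagger T
      rw [this]
      exact isometry_mulOp.isClosedEmbedding.isClosedMap _ isClosed_Bsymb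
    exact (hB.isClosedEmbedding_subtypeVal.isClosedMap _ hJ).preimage isometry_mulOp.continuous
  subset := by
    rintro f ⟨b, -, hf⟩
    obtain ⟨g, hg, hb⟩ := exists_eq_mulOp b
    rwa [mulOp_injective (hf.trans hb.symm)]
  zero_mem := ⟨0, J.zero_mem, map_zero _⟩
  add_mem := by
    rintro f g ⟨a, ha, hf⟩ ⟨b, hb, hg⟩
    exact ⟨a + b, J.add_mem ha hb, (map_add _ f g).trans (congrArg₂ _ hf hg)⟩
  mul_mem_left := by
    rintro f g hf ⟨b, hb, hg⟩
    exact ⟨⟨_, mulOp_mem_Bdagger hf⟩ * b, J.mul_mem_left _ _ hb,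
      (map_mul _ f g).trans (congrArg₂ _ rfl hg)⟩
  mul_mem_right := by
    rintro f g ⟨a, ha, hf⟩ hg
    exact ⟨a * ⟨_, mulOp_mem_Bdagger hg⟩, J.mul_mem_right _ _ ha,
      (map_mul _ f g).trans (congrArg₂ _ hf rfl)⟩
  commutator_mem := by
    intro f g hf hg
    refine ⟨_, h ⟨_, mulOp_mem_Bdagger hf⟩ ⟨_, mulOp_mem_Bdagger hg⟩, ?_⟩
    refine (map_sub (mulOp volume) (f * g) (g * f)).trans ?_
    rw [map_mul, map_mul]
    rfl

theorem mem_commutatorIdeal {b : Bdagger} :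
    b ∈ commutatorIdeal Bdagger ↔
      b.1 ∈ mulOp (E := L2Circ) (volume : Measure ℝ) '' compactSymb := by
  refine ⟨fun hb => mem_compactIdealBdagger.1 (commutatorIdeal_le hb), ?_⟩
  rintro ⟨f, hf, hfb⟩
  refine (TwoSidedIdeal.mem_sInf _).2 fun J hJ => ?_
  -- The commutator ideal is an infimum, so the lower bound is applied to each competing ideal `J`.
  obtain ⟨c, hc, hfc⟩ := compactSymb_subset (isCommutatorIdeal_symbols hJ.1 hJ.2) hf
  rwa [Subtype.ext (hfb.symm.trans hfc)]

/-- The whole algebra is a closed ideal containing all commutators, so the lower bound for ideals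
applies to it. -/
theorem compactSymb_subset_Bsymb : compactSymb ⊆ (Bsymb : Set Symb) := by
  have h := isCommutatorIdeal_symbols (J := ⊤) isClosed_univ fun _ _ => trivial
  exact (compactSymb_subset h).trans h.subset

end CommutatorIdeal

end CylinderAlgebra

end

theorem mainTheorem10 :
    Subtype.val '' (CylinderAlgebra.commutatorIdeal CylinderAlgebra.Bdagger :
        Set CylinderAlgebra.Bdagger) =
      Set.range CylinderAlgebra.mulC0 := by
  rw [CylinderAlgebra.range_mulC0]
  ext T
  constructor
  · rintro ⟨b, hb, rfl⟩
    exact CylinderAlgebra.mem_commutatorIdeal.1 hb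
  · rintro ⟨f, hf, rfl⟩
    exact ⟨⟨_, CylinderAlgebra.mulOp_mem_Bdagger (CylinderAlgebra.compactSymb_subset_Bsymb hf)⟩,
      CylinderAlgebra.mem_commutatorIdeal.2 ⟨f, hf, rfl⟩, rfl⟩
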